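/- Let $n\ge 1$, $p\in(1,\infty)$, $s\in(0,1)$ and $\Lambda\ge\lambda\ge 1$. There is a constant $c>0$, depending only on $n,p,s,\lambda,\Lambda$, such that the following holds. Let $K:\mathbb R^n\times\mathbb R^n\to[0,\infty)$ be measurable and symmetric ($K(x,y)=K(y,x)$) with $$\lambda\le K(x,y)\,|x-y|^{n+sp}\le\Lambda\qquad\text{for almost every }(x,y)\in\mathbb R^n\times\mathbb R^n .$$ Let $W^{s,p}(\mathbb R^n)$ be the space of $v\in L^p(\mathbb R^n)$ such that $\frac{|v(x)-v(y)|}{|x-y|^{n/p+s}}\in L^p(\mathbb R^n\times\mathbb R^n)$, let $\Omega\subset\mathbb R^n$ be a bounded open set, and let $W^{s,p}_0(\Omega)$ be the set of $v\in W^{s,p}(\mathbb R^n)$ with $v=0$ a.e. in $\mathbb R^n\setminus\Omega$. Let $g\in W^{s,p}(\mathbb R^n)$ and let $u\in W^{s,p}(\mathbb R^n)$ be a weak subsolution to the problem $\mathcal Lu=0$ in $\Omega$, $u=g$ in $\mathbb R^n\setminus\Omega$, where formally $\mathcal Lu(x)=\mathrm{P.V.}\int_{\mathbb R^n}K(x,y)|u(x)-u(y)|^{p-2}(u(x)-u(y))\,dy$;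 that is, $(g-u)_-=\max\{u-g,0\}\in W^{s,p}_0(\Omega)$ and $$\int_{\mathbb R^n}\int_{\mathbb R^n}K(x,y)\,|u(x)-u(y)|^{p-2}(u(x)-u(y))(\eta(x)-\eta(y))\,dx\,dy\le 0$$ for every nonnegative $\eta\in W^{s,p}_0(\Omega)$. Then for every open ball $B_r=B_r(x_0)\subset\Omega$, $r>0$, and every $\delta\in(0,1]$, $$\sup_{B_{r/2}(x_0)}u\;\le\;\delta\,\mathrm{Tail}(u_+;x_0,r/2)+c\,\delta^{-\frac{(p-1)n}{sp^2}}\left(\frac1{|B_r|}\int_{B_r(x_0)}u_+^p\,dx\right)^{1/p},$$ where $\sup$ is the essential supremum, $u_+=\max\{u,0\}$, and $$\mathrm{Tail}(v;x_0,R)=\left[R^{sp}\int_{\mathbb R^n\setminus B_R(x_0)}|v(x)|^{p-1}|x-x_0|^{-(n+sp)}\,dx\right]^{\frac1{p-1}} .$$ -/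

import Mathlib

open MeasureTheory Metric

noncomputable section

/-- The space `ℝⁿ` with its Euclidean norm. -/
abbrev Rn (n : ℕ) : Type := EuclideanSpace ℝ (Fin n)

/-- Membership in the fractional Sobolev space `W^{s,p}(ℝⁿ)`: `v ∈ L^p(ℝⁿ)` and
`|v(x) - v(y)| / |x - y|^{n/p + s} ∈ L^p(ℝⁿ × ℝⁿ)`. -/
def MemWsp {n : ℕ} (s p : ℝ) (v : Rn n → ℝ) : Prop :=
  MemLp v (ENNReal.ofReal p) volume ∧
    MemLp (fun z : Rn n × Rn n => |v z.1 - v z.2| / ‖z.1 - z.2‖ ^ ((n : ℝ) / p + s))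
      (ENNReal.ofReal p) volume

/-- Membership in `W₀^{s,p}(Ω)`: `v ∈ W^{s,p}(ℝⁿ)` and `v = 0` a.e. in `ℝⁿ ∖ Ω`. -/
def MemWspZero {n : ℕ} (s p : ℝ) (Ω : Set (Rn n)) (v : Rn n → ℝ) : Prop :=
  MemWsp s p v ∧ ∀ᵐ x : Rn n, x ∉ Ω → v x = 0

/-- Symmetric measurable kernels `K : ℝⁿ × ℝⁿ → [0,∞)` of order `(s,p)`, with
`lam ≤ K(x,y) |x - y|^{n+sp} ≤ Lam` for almost every `(x,y)`. Measurability is Lebesgue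
measurability on `ℝⁿ × ℝⁿ`. -/
structure IsKernel {n : ℕ} (s p lam Lam : ℝ) (K : Rn n → Rn n → ℝ) : Prop where
  aemeasurable : AEMeasurable (fun z : Rn n × Rn n => K z.1 z.2) volume
  nonneg : ∀ x y, 0 ≤ K x y
  symm : ∀ x y, K x y = K y x
  bounds : ∀ᵐ z : Rn n × Rn n,
    lam ≤ K z.1 z.2 * ‖z.1 - z.2‖ ^ ((n : ℝ) + s * p) ∧
      K z.1 z.2 * ‖z.1 - z.2‖ ^ ((n : ℝ) + s * p) ≤ Lam

/-- `u` is a weak subsolution of `L u = 0` in `Ω`, `u = g` in `ℝⁿ ∖ Ω`: it lies in `𝒦_g⁻(Ω)`, that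
is `u ∈ W^{s,p}(ℝⁿ)` and `(g - u)₋ ∈ W₀^{s,p}(Ω)`, and the weak inequality holds for every
nonnegative `η ∈ W₀^{s,p}(Ω)`. (By Hölder's inequality the integrand is integrable on `ℝⁿ × ℝⁿ`
for all `u, η ∈ W^{s,p}(ℝⁿ)` and every kernel as above.) -/
structure IsWeakSubsolution {n : ℕ} (s p : ℝ) (K : Rn n → Rn n → ℝ) (Ω : Set (Rn n))
    (g u : Rn n → ℝ) : Prop where
  memWsp : MemWsp s p u
  boundary : MemWspZero s p Ω (fun x => max (-(g x - u x)) 0)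
  weak : ∀ η : Rn n → ℝ, MemWspZero s p Ω η → (∀ᵐ x : Rn n, 0 ≤ η x) →
    ∫ z : Rn n × Rn n,
      K z.1 z.2 * |u z.1 - u z.2| ^ (p - 2) * (u z.1 - u z.2) * (η z.1 - η z.2) ≤ 0

/-- The nonlocal tail
`Tail(v; x₀, R) = [R^{sp} ∫_{ℝⁿ ∖ B_R(x₀)} |v(x)|^{p-1} |x - x₀|^{-(n+sp)} dx]^{1/(p-1)}`.
(By Hölder's inequality the integrand is integrable for `v ∈ L^p(ℝⁿ)` and `R > 0`.) -/
def tail {n : ℕ} (s p : ℝ) (v : Rn n → ℝ) (x₀ : Rn n) (R : ℝ) : ℝ :=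
  (R ^ (s * p) *
    ∫ x in (ball x₀ R)ᶜ, |v x| ^ (p - 1) * ‖x - x₀‖ ^ (-((n : ℝ) + s * p))) ^ (1 / (p - 1))

end

/-!
Local boundedness of subsolutions, by De Giorgi iteration on the truncations `w = (u - k)₊`.

The weak inequality is tested with `w φ^p`, where `φ` is a Lipschitz cutoff. Pairs of points on
different sides of the level `k` contribute at least `w(x)^p φ(x)^p` to the integrand. Pairs above
the level contribute at worst a multiple of `(w(x)^p + w(y)^p) |φ(x) - φ(y)|^p`, and the interaction
with the complement of the ball involves only the power `w(y)^{p-1}`, hence the tail. This gives the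
energy estimate `lintegral_crossing_le`, which bounds the crossing pairs
`∫_{u > k} w^p φ^p ∫_{u ≤ k} |x - y|^{-n-sp}`.

No Sobolev embedding is needed to exploit it, and the cases `sp < n` and `sp ≥ n` are treated alike:
if `{u > k}` has measure at most `M` near `x`, then at least half of the ball of measure `2M` around
`x` lies in `{u ≤ k}`, so that the inner integral is at least a multiple of `M^{-sp/n}`
(`le_lintegral_kernel_of_half`). If `M` is so large that this ball leaves the domain, the desired
gain `M^{sp/n}` is bounded below and there is nothing to prove. By Chebyshev's inequality
`M ≤ Y' / (k - k')^p`, with `Y'` the integral of `(u - k')₊^p` at a lower level `k'`. Hence the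
recursion `Y ≤ C Y'^{1 + sp/n}` of `exists_levelEnergy_step`, whose constant contains
`1 + (Tail / (k - k'))^{p-1}`.

For `k ≥ δ Tail` the tail costs a factor `δ^{1-p}`, and `fast_geometric_decay` shows that the
energies tend to zero once `k^{sp²/n}` is at least a multiple of `δ^{1-p}` times the power `sp/n` of
the mean of `u₊^p`. Solving for `k` produces the exponent `-(p-1)n/(sp²)` of `δ`.
-/

/-! ### Elementary inequalities -/

/-- The odd power `|t|^{p-2} t`, the nonlinearity of the fractional `p`-Laplacian. -/
noncomputable def flux (p t : ℝ) : ℝ := |t| ^ (p - 2) * t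

lemma flux_neg (p t : ℝ) : flux p (-t) = -flux p t := by
  simp [flux]

lemma flux_of_nonneg {p t : ℝ} (hp : 1 < p) (ht : 0 ≤ t) : flux p t = t ^ (p - 1) := by
  rcases ht.eq_or_lt with rfl | ht
  · rw [Real.zero_rpow (by linarith)]; simp [flux]
  · rw [flux, abs_of_pos ht]
    nth_rewrite 2 [← Real.rpow_one t]
    rw [← Real.rpow_add ht]
    ring_nf

lemma rpow_sub_rpow_le {p a b : ℝ} (hp : 1 < p) (ha : 0 ≤ a) (hab : a ≤ b) :
    b ^ p - a ^ p ≤ p * b ^ (p - 1) * (b - a) := by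
  rcases (ha.trans hab).eq_or_lt with hb | hb
  · have : a = b := le_antisymm hab (hb ▸ ha)
    simp [this]
  · have h := one_add_mul_self_le_rpow_one_add (s := a / b - 1) (by
      have := div_nonneg ha hb.le; linarith) hp.le
    have e : 1 + (a / b - 1) = a / b := by ring
    rw [e, Real.div_rpow ha hb.le] at h
    have hbp : 0 < b ^ p := Real.rpow_pos_of_pos hb p
    have hb1 : b ^ p = b ^ (p - 1) * b := by
      nth_rewrite 3 [← Real.rpow_one b]
      rw [← Real.rpow_add hb]; ring_nf
    rw [le_div_iff₀ hbp] at h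
    have h2 : (1 + p * (a / b - 1)) * b ^ p = b ^ p - p * b ^ (p - 1) * (b - a) := by
      rw [hb1]; field_simp; ring
    linarith

lemma rpow_sub_one_mul_self {p t : ℝ} (hp : 1 < p) (ht : 0 ≤ t) : t ^ (p - 1) * t = t ^ p := by
  rcases ht.eq_or_lt with rfl | ht
  · rw [Real.zero_rpow (by linarith), Real.zero_rpow (by linarith)]; simp
  · nth_rewrite 2 [← Real.rpow_one t]
    rw [← Real.rpow_add ht]; ring_nf

lemma abs_rpow_sub_rpow_le {p a b : ℝ} (hp : 1 < p) (ha : 0 ≤ a) (ha1 : a ≤ 1) (hb : 0 ≤ b)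
    (hb1 : b ≤ 1) : |a ^ p - b ^ p| ≤ p * |a - b| := by
  wlog h : b ≤ a generalizing a b
  · rw [abs_sub_comm, abs_sub_comm a]; exact this hb hb1 ha ha1 (le_of_not_ge h)
  rw [abs_of_nonneg (sub_nonneg.2 (Real.rpow_le_rpow hb h (by linarith))),
    abs_of_nonneg (sub_nonneg.2 h)]
  refine (rpow_sub_rpow_le hp hb h).trans ?_
  have : a ^ (p - 1) ≤ 1 := Real.rpow_le_one ha ha1 (by linarith)
  have h3 : p * a ^ (p - 1) ≤ p * 1 := by gcongr
  nlinarith [mul_le_mul_of_nonneg_right h3 (sub_nonneg.2 h)]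

/-- A crude form of Young's inequality: `a^{p-1} b ≤ a^p + b^p`. -/
lemma rpow_sub_one_mul_le {p a b : ℝ} (hp : 1 < p) (ha : 0 ≤ a) (hb : 0 ≤ b) :
    a ^ (p - 1) * b ≤ a ^ p + b ^ p := by
  rcases le_total a b with h | h
  · have : a ^ (p - 1) * b ≤ b ^ (p - 1) * b := by
      gcongr
    rw [rpow_sub_one_mul_self hp hb] at this
    linarith [Real.rpow_nonneg ha p]
  · have : a ^ (p - 1) * b ≤ a ^ (p - 1) * a := by gcongr
    rw [rpow_sub_one_mul_self hp ha] at this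
    linarith [Real.rpow_nonneg hb p]

/-- The contribution of two points above the level: the cutoff costs at most a multiple of
`|f - g|^p`. -/
lemma flux_mul_ge_of_nonneg {p a b f g : ℝ} (hp : 1 < p) (ha : 0 ≤ a) (hb : 0 ≤ b)
    (hf : 0 ≤ f) (hg : 0 ≤ g) :
    -(p ^ p * (a ^ p + b ^ p) * |f - g| ^ p) ≤ flux p (a - b) * (a * f ^ p - b * g ^ p) := by
  wlog hab : b ≤ a generalizing a b f g
  · have h := this hb ha hg hf (le_of_not_ge hab)
    have e : flux p (b - a) = - flux p (a - b) := by rw [← flux_neg]; ring_nf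
    rw [e, abs_sub_comm] at h
    linarith
  have ht : 0 ≤ a - b := sub_nonneg.2 hab
  rw [flux_of_nonneg hp ht]
  have hp0 : (0 : ℝ) < p := by linarith
  have hR : 0 ≤ p ^ p * (a ^ p + b ^ p) * |f - g| ^ p := by positivity
  rcases le_total g f with h | h
  · have : b * g ^ p ≤ a * f ^ p := by gcongr
    have := mul_nonneg (Real.rpow_nonneg ht (p - 1)) (sub_nonneg.2 this)
    linarith
  · set X := (a - b) * g with hX
    set Y := a * (g - f) with hY
    have hX0 : 0 ≤ X := mul_nonneg ht hg
    have hY0 : 0 ≤ Y := mul_nonneg ha (sub_nonneg.2 h)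
    have key : X ^ (p - 1) * (X - p * Y) ≤ (a - b) ^ (p - 1) * (a * f ^ p - b * g ^ p) := by
      have h1 := rpow_sub_rpow_le hp hf h
      have e : X ^ (p - 1) * (X - p * Y)
          = (a - b) ^ (p - 1) * ((a - b) * (g ^ (p - 1) * g) - a * (p * g ^ (p - 1) * (g - f))) := by
        rw [hX, Real.mul_rpow ht hg, hY]; ring
      rw [e, rpow_sub_one_mul_self hp hg]
      refine mul_le_mul_of_nonneg_left ?_ (Real.rpow_nonneg ht _)
      nlinarith [mul_le_mul_of_nonneg_left h1 ha]
    refine le_trans ?_ key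
    rcases le_total (p * Y) X with h2 | h2
    · have := mul_nonneg (Real.rpow_nonneg hX0 (p - 1)) (sub_nonneg.2 h2)
      linarith
    · have h3 : X ^ (p - 1) * (p * Y) ≤ (p * Y) ^ (p - 1) * (p * Y) := by
        gcongr
      rw [rpow_sub_one_mul_self hp (by positivity), Real.mul_rpow hp0.le hY0, hY,
        Real.mul_rpow ha (sub_nonneg.2 h)] at h3
      have h4 : 0 ≤ X ^ (p - 1) * X := by positivity
      have h5 : |f - g| = g - f := by rw [abs_sub_comm, abs_of_nonneg (sub_nonneg.2 h)]
      rw [h5]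
      have h6 : 0 ≤ p ^ p * b ^ p * (g - f) ^ p := by
        have := sub_nonneg.2 h
        positivity
      rw [← hY] at h3
      nlinarith

/-- Pointwise lower bound near the diagonal: pairs on different sides of the level `k` produce the
full power of the truncation, the other pairs produce at worst the cost of the cutoff. -/
lemma flux_truncation_ge {p a b k f g : ℝ} (hp : 1 < p) (hf : 0 ≤ f) (hg : 0 ≤ g) :
    (if k < a ∧ b ≤ k then max (a - k) 0 ^ p * f ^ p else 0)
      ≤ flux p (a - b) * (max (a - k) 0 * f ^ p - max (b - k) 0 * g ^ p)
        + p ^ p * (max (a - k) 0 ^ p + max (b - k) 0 ^ p) * |f - g| ^ p := by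
  have hp0 : (0 : ℝ) < p := by linarith
  have hR : 0 ≤ p ^ p * (max (a - k) 0 ^ p + max (b - k) 0 ^ p) * |f - g| ^ p := by positivity
  rcases le_or_gt a k with ha | ha <;> rcases le_or_gt b k with hb | hb
  · rw [if_neg (by rintro ⟨h, -⟩; linarith)]
    rw [max_eq_right (sub_nonpos.2 ha), max_eq_right (sub_nonpos.2 hb)] at *
    linarith
  · have e : flux p (a - b) = - (b - a) ^ (p - 1) := by
      rw [← flux_of_nonneg hp (by linarith), ← flux_neg]; ring_nf
    rw [if_neg (by intro h; linarith [h.1]), e]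
    rw [max_eq_right (sub_nonpos.2 ha)] at *
    have : 0 ≤ (b - a) ^ (p - 1) * (max (b - k) 0 * g ^ p) :=
      mul_nonneg (Real.rpow_nonneg (by linarith) _) (by positivity)
    linarith
  · rw [if_pos ⟨ha, hb⟩, flux_of_nonneg hp (by linarith)]
    rw [max_eq_right (sub_nonpos.2 hb), max_eq_left (by linarith : (0 : ℝ) ≤ a - k)] at *
    have h1 : (a - k) ^ (p - 1) ≤ (a - b) ^ (p - 1) :=
      Real.rpow_le_rpow (by linarith) (by linarith) (by linarith)
    have h2 := mul_le_mul_of_nonneg_right h1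
      (mul_nonneg (by linarith : (0 : ℝ) ≤ a - k) (Real.rpow_nonneg hf p))
    rw [← mul_assoc, rpow_sub_one_mul_self hp (by linarith)] at h2
    linarith
  · rw [if_neg (by intro h; linarith [h.2])]
    rw [max_eq_left (by linarith : (0 : ℝ) ≤ a - k),
      max_eq_left (by linarith : (0 : ℝ) ≤ b - k)] at *
    have := flux_mul_ge_of_nonneg (a := a - k) (b := b - k) hp (by linarith) (by linarith) hf hg
    have e : a - k - (b - k) = a - b := by ring
    rw [e] at this
    linarith

/-- Pointwise lower bound far from the diagonal, where the second point lies outside the support of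
the cutoff. Only the power `p - 1` of the far value enters, as in the tail. -/
lemma flux_truncation_ge_far {p a b k f : ℝ} (hp : 1 < p) (hf : 0 ≤ f) :
    (if k < a ∧ b ≤ k then max (a - k) 0 ^ p * f ^ p else 0)
      ≤ flux p (a - b) * (max (a - k) 0 * f ^ p)
        + max (b - k) 0 ^ (p - 1) * (max (a - k) 0 * f ^ p) := by
  have hfp := Real.rpow_nonneg hf p
  rcases le_or_gt a k with ha | ha
  · rw [if_neg (by intro h; linarith [h.1]), max_eq_right (sub_nonpos.2 ha)]; simp
  rw [max_eq_left (by linarith : (0 : ℝ) ≤ a - k)]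
  have hak : 0 ≤ (a - k) * f ^ p := mul_nonneg (by linarith) hfp
  rcases le_or_gt b k with hb | hb
  · rw [if_pos ⟨ha, hb⟩, flux_of_nonneg hp (by linarith), max_eq_right (sub_nonpos.2 hb),
      Real.zero_rpow (by linarith)]
    have h1 : (a - k) ^ (p - 1) ≤ (a - b) ^ (p - 1) :=
      Real.rpow_le_rpow (by linarith) (by linarith) (by linarith)
    have h2 := mul_le_mul_of_nonneg_right h1 hak
    rw [← mul_assoc, rpow_sub_one_mul_self hp (by linarith)] at h2
    linarith
  · rw [if_neg (by intro h; linarith [h.2]), max_eq_left (by linarith : (0 : ℝ) ≤ b - k),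
      ← add_mul]
    refine mul_nonneg ?_ hak
    rcases le_total b a with h | h
    · rw [flux_of_nonneg hp (by linarith)]
      exact add_nonneg (Real.rpow_nonneg (by linarith) _) (Real.rpow_nonneg (by linarith) _)
    · have e : flux p (a - b) = - (b - a) ^ (p - 1) := by
        rw [← flux_of_nonneg hp (by linarith), ← flux_neg]; ring_nf
      rw [e]
      have : (b - a) ^ (p - 1) ≤ (b - k) ^ (p - 1) :=
        Real.rpow_le_rpow (by linarith) (by linarith) (by linarith)
      linarith

/-- Chebyshev-type comparison of truncations at two levels. -/
lemma max_sub_le_rpow {p a k k' : ℝ} (hp : 1 < p) (hk : k' < k) :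
    max (a - k) 0 ≤ (k - k') ^ (1 - p) * max (a - k') 0 ^ p := by
  have hd : 0 < k - k' := by linarith
  rcases le_or_gt a k with ha | ha
  · rw [max_eq_right (sub_nonpos.2 ha)]; positivity
  · rw [max_eq_left (by linarith), max_eq_left (by linarith),
      ← rpow_sub_one_mul_self hp (by linarith), ← mul_assoc]
    have h1 : (k - k') ^ (p - 1) ≤ (a - k') ^ (p - 1) :=
      Real.rpow_le_rpow hd.le (by linarith) (by linarith)
    have h2 : (k - k') ^ (1 - p) * (k - k') ^ (p - 1) = 1 := by
      rw [← Real.rpow_add hd]; simp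
    have h3 := mul_le_mul_of_nonneg_left h1 (Real.rpow_nonneg hd.le (1 - p))
    rw [h2] at h3
    nlinarith

/-- Fast geometric convergence: a recursion `Y (j+1) ≤ A b^j Y_j^{1+β}` forces `Y j → 0` when the
initial value is small. -/
lemma fast_geometric_decay {Y : ℕ → ℝ} {A b β : ℝ} (hA : 0 ≤ A) (hb : 1 < b) (hβ : 0 < β)
    (hY : ∀ j, 0 ≤ Y j) (hrec : ∀ j, Y (j + 1) ≤ A * b ^ j * Y j ^ (1 + β))
    (h0 : A * Y 0 ^ β * b ^ (1 / β) ≤ 1) (j : ℕ) : Y j ≤ Y 0 * (b ^ (-(1 / β))) ^ j := by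
  have hb0 : 0 < b := by linarith
  set q := b ^ (-(1 / β)) with hq
  have hq0 : 0 < q := Real.rpow_pos_of_pos hb0 _
  have hqβ : q ^ β = b⁻¹ := by
    rw [hq, ← Real.rpow_mul hb0.le, neg_mul, one_div_mul_cancel hβ.ne', Real.rpow_neg_one]
  have hqb : q * b ^ (1 / β) = 1 := by rw [hq, ← Real.rpow_add hb0]; simp
  induction j with
  | zero => simp
  | succ j ih =>
    have hqj : (q ^ j) ^ β = (b ^ j)⁻¹ := by
      rw [← Real.rpow_natCast, ← Real.rpow_mul hq0.le, mul_comm, Real.rpow_mul hq0.le, hqβ,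
        Real.rpow_natCast, inv_pow]
    have hbj : 0 < b ^ j := pow_pos hb0 j
    calc Y (j + 1) ≤ A * b ^ j * Y j ^ (1 + β) := hrec j
      _ ≤ A * b ^ j * (Y 0 * q ^ j) ^ (1 + β) := by
        gcongr
        exact hY j
      _ = A * Y 0 ^ β * (Y 0 * q ^ j) := by
        have h1 : 0 ≤ Y 0 * q ^ j := mul_nonneg (hY 0) (by positivity)
        rw [Real.rpow_add_of_nonneg h1 zero_le_one hβ.le, Real.rpow_one,
          Real.mul_rpow (hY 0) (by positivity), hqj]
        field_simp
      _ = (A * Y 0 ^ β * b ^ (1 / β)) * (Y 0 * q ^ (j + 1)) := by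
        rw [pow_succ]
        linear_combination (-(A * Y 0 ^ β * (Y 0 * q ^ j))) * hqb
      _ ≤ 1 * (Y 0 * q ^ (j + 1)) := by
        gcongr
        exact mul_nonneg (hY 0) (by positivity)
      _ = _ := one_mul _

/-! ### Integrals of the kernel -/

lemma integrable_min_rpow_mul_rpow {n : ℕ} (hn : 1 ≤ n) {s p : ℝ} (hs0 : 0 < s) (hs1 : s < 1)
    (hp : 1 < p) :
    Integrable (fun z : Rn n => min 1 ‖z‖ ^ p * ‖z‖ ^ (-((n : ℝ) + s * p))) volume := by
  have : Nonempty (Fin n) := ⟨⟨0, hn⟩⟩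
  have hsp : 0 < s * p := by positivity
  rw [integrable_fun_norm_addHaar volume (f := fun t => min 1 t ^ p * t ^ (-((n : ℝ) + s * p)))]
  have hdim : Module.finrank ℝ (Rn n) = n := by simp
  rw [hdim, ← Set.Ioc_union_Ioi_eq_Ioi (zero_le_one' ℝ)]
  have hpow : ∀ t : ℝ, 0 < t → t ^ (n - 1) = t ^ ((n : ℝ) - 1) := by
    intro t ht
    rw [← Real.rpow_natCast, Nat.cast_sub hn, Nat.cast_one]
  refine IntegrableOn.union ?_ ?_
  · have h := (intervalIntegral.intervalIntegrable_rpow' (a := 0) (b := 1)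
      (r := p - s * p - 1) (by nlinarith)).1
    refine h.congr_fun (fun t ht => ?_) measurableSet_Ioc
    have ht0 : 0 < t := ht.1
    simp only [smul_eq_mul]
    rw [min_eq_right ht.2, hpow t ht0, ← Real.rpow_add ht0, ← Real.rpow_add ht0]
    ring_nf
  · have h := integrableOn_Ioi_rpow_of_lt (a := -1 - s * p) (c := 1) (by linarith) one_pos
    refine h.congr_fun (fun t ht => ?_) measurableSet_Ioi
    have ht1 : (1 : ℝ) < t := ht
    have ht0 : 0 < t := by linarith
    simp only [smul_eq_mul]
    rw [min_eq_left ht1.le, hpow t ht0, Real.one_rpow, one_mul, ← Real.rpow_add ht0]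
    ring_nf

/-- The integral which controls both the cutoff near the diagonal (because `s < 1`) and the kernel
away from it (because `s > 0`), with its scaling in the length `h`. -/
lemma exists_lintegral_min_kernel_le {n : ℕ} (hn : 1 ≤ n) {s p : ℝ} (hs0 : 0 < s) (hs1 : s < 1)
    (hp : 1 < p) :
    ∃ C : ℝ, 0 < C ∧ ∀ h : ℝ, 0 < h → ∀ x : Rn n,
      ∫⁻ y, ENNReal.ofReal (min 1 (‖x - y‖ / h) ^ p * ‖x - y‖ ^ (-((n : ℝ) + s * p)))
        ≤ ENNReal.ofReal (C * h ^ (-(s * p))) := by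
  set f : Rn n → ℝ := fun z => min 1 ‖z‖ ^ p * ‖z‖ ^ (-((n : ℝ) + s * p)) with hf
  have hfi : Integrable f volume := integrable_min_rpow_mul_rpow hn hs0 hs1 hp
  have hf0 : 0 ≤ ∫ z, f z := integral_nonneg fun z => by
    have : 0 ≤ min 1 ‖z‖ := le_min zero_le_one (norm_nonneg _)
    simp only [hf, Pi.zero_apply]; positivity
  refine ⟨(∫ z, f z) + 1, by linarith, fun h hh x => ?_⟩
  set F : Rn n → ℝ := fun z => min 1 (‖z‖ / h) ^ p * ‖z‖ ^ (-((n : ℝ) + s * p)) with hF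
  have hFf : F = fun z => h ^ (-((n : ℝ) + s * p)) * f (h⁻¹ • z) := by
    ext z
    simp only [hF, hf]
    rw [norm_smul, norm_inv, Real.norm_of_nonneg hh.le, inv_mul_eq_div,
      Real.div_rpow (norm_nonneg _) hh.le]
    have := (Real.rpow_pos_of_pos hh (-((n : ℝ) + s * p))).ne'
    field_simp
  have hFi : Integrable F volume := by
    rw [hFf]; exact (hfi.comp_smul (inv_ne_zero hh.ne')).const_mul _
  have hFint : ∫ z, F z = h ^ (-(s * p)) * ∫ z, f z := by
    rw [hFf, integral_const_mul, Measure.integral_comp_smul]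
    have hdim : Module.finrank ℝ (Rn n) = n := by simp
    rw [hdim, smul_eq_mul, inv_pow, inv_inv, abs_of_pos (by positivity), ← mul_assoc,
      ← Real.rpow_natCast, ← Real.rpow_add hh]
    ring_nf
  calc _ = ∫⁻ y, ENNReal.ofReal (F (x - y)) := rfl
    _ = ∫⁻ z, ENNReal.ofReal (F z) :=
        lintegral_sub_left_eq_self (fun z => ENNReal.ofReal (F z)) x
    _ = ENNReal.ofReal (∫ z, F z) := by
        rw [ofReal_integral_eq_lintegral_ofReal hFi]
        refine Filter.Eventually.of_forall fun z => ?_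
        have : 0 ≤ min 1 (‖z‖ / h) := le_min zero_le_one (by positivity)
        simp only [hF, Pi.zero_apply]; positivity
    _ ≤ _ := by
        rw [hFint]
        refine ENNReal.ofReal_le_ofReal ?_
        nlinarith [Real.rpow_pos_of_pos hh (-(s * p))]

lemma lintegral_kernel_compl_ball_lt_top {n : ℕ} (hn : 1 ≤ n) {s p : ℝ} (hs0 : 0 < s) (hs1 : s < 1)
    (hp : 1 < p) (x₀ : Rn n) {R : ℝ} (hR : 0 < R) :
    ∫⁻ x in (ball x₀ R)ᶜ, ENNReal.ofReal (‖x - x₀‖ ^ (-((n : ℝ) + s * p))) < ⊤ := by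
  obtain ⟨C, hC, h⟩ := exists_lintegral_min_kernel_le hn hs0 hs1 hp
  refine lt_of_le_of_lt ?_ ((h R hR x₀).trans_lt ENNReal.ofReal_lt_top)
  refine le_trans (setLIntegral_mono' measurableSet_ball.compl fun x hx => ?_)
    (setLIntegral_le_lintegral _ _)
  have hx' : R ≤ ‖x - x₀‖ := by simpa [dist_eq_norm] using hx
  rw [norm_sub_rev x₀ x, min_eq_left ((one_le_div hR).2 hx'), Real.one_rpow, one_mul]

/-- The tail integrand of an `L^p` function is integrable away from the centre. -/
lemma integrableOn_tail {n : ℕ} (hn : 1 ≤ n) {s p : ℝ} (hs0 : 0 < s) (hs1 : s < 1)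
    (hp : 1 < p) {v : Rn n → ℝ} (hv : Measurable v)
    (hvp : Integrable (fun x => |v x| ^ p) volume) (x₀ : Rn n) {R : ℝ} (hR : 0 < R) :
    IntegrableOn (fun x => |v x| ^ (p - 1) * ‖x - x₀‖ ^ (-((n : ℝ) + s * p))) (ball x₀ R)ᶜ
      volume := by
  have hJ : IntegrableOn (fun x => ‖x - x₀‖ ^ (-((n : ℝ) + s * p))) (ball x₀ R)ᶜ volume := by
    refine ⟨(by fun_prop : Measurable _).aestronglyMeasurable, ?_⟩
    rw [hasFiniteIntegral_iff_ofReal (Filter.Eventually.of_forall fun x => by positivity)]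
    exact lintegral_kernel_compl_ball_lt_top hn hs0 hs1 hp x₀ hR
  refine Integrable.mono' (hJ.add ((hvp.integrableOn).const_mul (R ^ (-((n : ℝ) + s * p)))))
    (by fun_prop : Measurable _).aestronglyMeasurable ?_
  refine (ae_restrict_iff' measurableSet_ball.compl).2 (Filter.Eventually.of_forall fun x hx => ?_)
  have hx' : R ≤ ‖x - x₀‖ := by simpa [dist_eq_norm] using hx
  rw [Real.norm_of_nonneg (by positivity)]
  have h1 := rpow_sub_one_mul_le hp (abs_nonneg (v x)) zero_le_one
  rw [mul_one, Real.one_rpow] at h1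
  have h2 : ‖x - x₀‖ ^ (-((n : ℝ) + s * p)) ≤ R ^ (-((n : ℝ) + s * p)) :=
    Real.rpow_le_rpow_of_nonpos hR hx' (by
      have : 0 < s * p := by positivity
      have : (0 : ℝ) ≤ n := n.cast_nonneg
      linarith)
  have h3 : 0 ≤ ‖x - x₀‖ ^ (-((n : ℝ) + s * p)) := by positivity
  have h4 : 0 ≤ |v x| ^ p := by positivity
  simp only [Pi.add_apply]
  nlinarith [mul_le_mul_of_nonneg_right h1 h3, mul_le_mul_of_nonneg_right h2 h4]

/-- If at most half of the ball `B_R(x)` lies outside the set `S`, then `S` carries a definite part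
of the kernel centred at `x`. This is the only replacement needed for a Sobolev inequality. -/
lemma le_lintegral_kernel_of_half {n : ℕ} (hn : 1 ≤ n) {s p : ℝ} (hsp : 0 < s * p)
    {S : Set (Rn n)} (hS : MeasurableSet S) (x : Rn n) {R : ℝ}
    (hhalf : volume (ball x R \ S) ≤ volume (ball x R) / 2) :
    ENNReal.ofReal (R ^ (-((n : ℝ) + s * p))) * (volume (ball x R) / 2)
      ≤ ∫⁻ y in S, ENNReal.ofReal (‖x - y‖ ^ (-((n : ℝ) + s * p))) := by
  have : Nonempty (Fin n) := ⟨⟨0, hn⟩⟩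
  have hfin : volume (ball x R) ≠ ⊤ := measure_ball_lt_top.ne
  have h1 : volume (ball x R) / 2 ≤ volume ((ball x R ∩ S) \ {x}) := by
    rw [measure_sdiff_null (measure_singleton x)]
    have h := measure_inter_add_sdiff (μ := volume) (ball x R) hS
    have h2 : volume (ball x R) / 2 + volume (ball x R) / 2
        ≤ volume (ball x R ∩ S) + volume (ball x R) / 2 := by
      rw [ENNReal.add_halves]
      calc _ = _ := h.symm
        _ ≤ _ := by gcongr
    exact (ENNReal.add_le_add_iff_right (ENNReal.div_ne_top hfin two_ne_zero)).1 h2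
  refine (mul_le_mul_right h1 _).trans ?_
  rw [← setLIntegral_const]
  refine le_trans (setLIntegral_mono'
    ((measurableSet_ball.inter hS).diff (measurableSet_singleton x)) fun y hy => ?_)
    (lintegral_mono_set (fun y hy => hy.1.2))
  refine ENNReal.ofReal_le_ofReal ?_
  have hy1 : dist y x < R := hy.1.1
  have hy2 : y ≠ x := hy.2
  rw [dist_comm, dist_eq_norm] at hy1
  refine Real.rpow_le_rpow_of_nonpos (norm_pos_iff.2 (sub_ne_zero.2 hy2.symm)) hy1.le ?_
  have : (0 : ℝ) ≤ n := n.cast_nonneg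
  linarith

/-! ### Cutoffs and admissible test functions -/

/-- The radial cutoff which vanishes outside `B_ρ(x₀)`, equals `1` on `B_{ρ-h}(x₀)` and has
Lipschitz constant `1 / h`. -/
noncomputable def cutoff {n : ℕ} (x₀ : Rn n) (ρ h : ℝ) (x : Rn n) : ℝ :=
  max 0 (min 1 ((ρ - ‖x - x₀‖) / h))

section cutoff

variable {n : ℕ} {x₀ : Rn n} {ρ h : ℝ}

lemma cutoff_nonneg (x : Rn n) : 0 ≤ cutoff x₀ ρ h x := le_max_left _ _

lemma cutoff_le_one (x : Rn n) : cutoff x₀ ρ h x ≤ 1 := max_le zero_le_one (min_le_left _ _)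

lemma cutoff_eq_zero (hh : 0 < h) {x : Rn n} (hx : ρ ≤ ‖x - x₀‖) : cutoff x₀ ρ h x = 0 := by
  refine max_eq_left ((min_le_right _ _).trans ?_)
  exact div_nonpos_of_nonpos_of_nonneg (by linarith) hh.le

lemma cutoff_eq_one (hh : 0 < h) {x : Rn n} (hx : ‖x - x₀‖ ≤ ρ - h) : cutoff x₀ ρ h x = 1 := by
  rw [cutoff, min_eq_left ((one_le_div hh).2 (by linarith)), max_eq_right zero_le_one]

@[fun_prop]
lemma measurable_cutoff : Measurable (cutoff x₀ ρ h) := by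
  unfold cutoff; fun_prop

lemma abs_cutoff_sub_le (hh : 0 < h) (x y : Rn n) :
    |cutoff x₀ ρ h x - cutoff x₀ ρ h y| ≤ min 1 (‖x - y‖ / h) := by
  refine le_min ?_ ?_
  · have := cutoff_nonneg (x₀ := x₀) (ρ := ρ) (h := h) x
    have := cutoff_nonneg (x₀ := x₀) (ρ := ρ) (h := h) y
    have := cutoff_le_one (x₀ := x₀) (ρ := ρ) (h := h) x
    have := cutoff_le_one (x₀ := x₀) (ρ := ρ) (h := h) y
    rw [abs_le]; constructor <;> linarith
  · unfold cutoff
    refine (abs_max_sub_max_le_max _ _ _ _).trans ?_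
    refine max_le (by simp; positivity) ?_
    refine (abs_min_sub_min_le_max _ _ _ _).trans ?_
    refine max_le (by simp; positivity) ?_
    rw [← sub_div, abs_div, abs_of_pos hh]
    gcongr
    have := abs_norm_sub_norm_le (y - x₀) (x - x₀)
    rw [sub_sub_sub_cancel_right, norm_sub_rev y x] at this
    have e : ρ - ‖x - x₀‖ - (ρ - ‖y - x₀‖) = ‖y - x₀‖ - ‖x - x₀‖ := by ring
    rwa [e]

end cutoff

lemma rpow_div_add_rpow {n : ℕ} {s p : ℝ} (hp : 1 < p) {t : ℝ} (ht : 0 ≤ t) :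
    (t ^ ((n : ℝ) / p + s)) ^ p = t ^ ((n : ℝ) + s * p) := by
  rw [← Real.rpow_mul ht]
  congr 1
  have : p ≠ 0 := by linarith
  field_simp

lemma MemWsp.integrable_rpow {n : ℕ} {s p : ℝ} (hp : 1 < p) {v : Rn n → ℝ} (hv : MemWsp s p v) :
    Integrable (fun x => |v x| ^ p) volume := by
  have h := hv.1.integrable_norm_rpow (by simp; linarith) ENNReal.ofReal_ne_top
  rwa [ENNReal.toReal_ofReal (by linarith)] at h

lemma MemWsp.integrable_quotient_rpow {n : ℕ} {s p : ℝ} (hp : 1 < p) {v : Rn n → ℝ}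
    (hv : MemWsp s p v) :
    Integrable (fun z : Rn n × Rn n =>
      (|v z.1 - v z.2| / ‖z.1 - z.2‖ ^ ((n : ℝ) / p + s)) ^ p) volume := by
  have h := hv.2.integrable_norm_rpow (by simp; linarith) ENNReal.ofReal_ne_top
  rw [ENNReal.toReal_ofReal (by linarith)] at h
  refine h.congr (Filter.Eventually.of_forall fun z => ?_)
  simp only
  rw [Real.norm_of_nonneg (by positivity)]

lemma memLp_of_integrable_rpow {α : Type*} [MeasurableSpace α] {μ : Measure α} {p : ℝ}
    (hp : 1 < p) {f : α → ℝ} (hf : AEStronglyMeasurable f μ)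
    (h : ∫⁻ x, ENNReal.ofReal (|f x| ^ p) ∂μ < ⊤) : MemLp f (ENNReal.ofReal p) μ := by
  refine ⟨hf, ?_⟩
  rw [eLpNorm_lt_top_iff_lintegral_rpow_enorm_lt_top (by simp; linarith) ENNReal.ofReal_ne_top,
    ENNReal.toReal_ofReal (by linarith)]
  refine lt_of_le_of_lt (le_of_eq (lintegral_congr fun x => ?_)) h
  rw [← ENNReal.ofReal_rpow_of_nonneg (abs_nonneg _) (by linarith), ← Real.norm_eq_abs,
    ofReal_norm]

/-- Multiplying an `L^p` function by the increments of a Lipschitz cutoff gives a function with the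
integrability of a `W^{s,p}` difference quotient. -/
lemma memLp_mul_min_quotient {n : ℕ} (hn : 1 ≤ n) {s p : ℝ} (hs0 : 0 < s) (hs1 : s < 1)
    (hp : 1 < p) {u : Rn n → ℝ} (hu : Measurable u)
    (hup : Integrable (fun x => |u x| ^ p) volume) {h : ℝ} (hh : 0 < h) :
    MemLp (fun z : Rn n × Rn n =>
      |u z.1| * min 1 (‖z.1 - z.2‖ / h) / ‖z.1 - z.2‖ ^ ((n : ℝ) / p + s))
      (ENNReal.ofReal p) volume := by
  obtain ⟨C, hC, hker⟩ := exists_lintegral_min_kernel_le hn hs0 hs1 hp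
  refine memLp_of_integrable_rpow hp (by fun_prop : Measurable _).aestronglyMeasurable ?_
  have e : ∀ z : Rn n × Rn n,
      ENNReal.ofReal (|(|u z.1| * min 1 (‖z.1 - z.2‖ / h) / ‖z.1 - z.2‖ ^ ((n : ℝ) / p + s))| ^ p)
      = ENNReal.ofReal (|u z.1| ^ p) * ENNReal.ofReal
        (min 1 (‖z.1 - z.2‖ / h) ^ p * ‖z.1 - z.2‖ ^ (-((n : ℝ) + s * p))) := by
    intro z
    have hm : 0 ≤ min 1 (‖z.1 - z.2‖ / h) := le_min zero_le_one (by positivity)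
    rw [← ENNReal.ofReal_mul (by positivity), abs_of_nonneg (by positivity),
      Real.div_rpow (by positivity) (by positivity), Real.mul_rpow (abs_nonneg _) hm,
      rpow_div_add_rpow hp (norm_nonneg _), Real.rpow_neg (norm_nonneg _), div_eq_mul_inv,
      mul_assoc]
  simp_rw [e]
  rw [Measure.volume_eq_prod, lintegral_prod _ (by fun_prop : Measurable _).aemeasurable]
  calc _ ≤ ∫⁻ x, ENNReal.ofReal (|u x| ^ p) * ENNReal.ofReal (C * h ^ (-(s * p))) := by
        refine lintegral_mono fun x => ?_
        simp only
        rw [lintegral_const_mul _ (by fun_prop)]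
        gcongr
        exact hker h hh x
    _ < ⊤ := by
        rw [lintegral_mul_const _ (by fun_prop)]
        refine ENNReal.mul_lt_top ?_ ENNReal.ofReal_lt_top
        rw [← ofReal_integral_eq_lintegral_ofReal hup
          (Filter.Eventually.of_forall fun x => by simp only [Pi.zero_apply]; positivity)]
        exact ENNReal.ofReal_lt_top

/-- Truncations of `W^{s,p}` functions, multiplied by a power of a Lipschitz cutoff supported in `Ω`,
are admissible test functions. -/
lemma memWspZero_truncation_mul_cutoff {n : ℕ} (hn : 1 ≤ n) {s p : ℝ} (hs0 : 0 < s) (hs1 : s < 1)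
    (hp : 1 < p) {u : Rn n → ℝ} (hu : Measurable u) (huW : MemWsp s p u) {k : ℝ} (hk : 0 ≤ k)
    {x₀ : Rn n} {ρ h : ℝ} (hh : 0 < h) {Ω : Set (Rn n)} (hΩ : ball x₀ ρ ⊆ Ω) :
    MemWspZero s p Ω (fun x => max (u x - k) 0 * cutoff x₀ ρ h x ^ p) := by
  have hp0 : 0 < p := by linarith
  have hw : ∀ x, max (u x - k) 0 ≤ |u x| := fun x =>
    max_le (by linarith [le_abs_self (u x)]) (abs_nonneg _)
  have hφ0 := cutoff_nonneg (x₀ := x₀) (ρ := ρ) (h := h)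
  have hφ1 := cutoff_le_one (x₀ := x₀) (ρ := ρ) (h := h)
  have hφp1 : ∀ x, cutoff x₀ ρ h x ^ p ≤ 1 := fun x => Real.rpow_le_one (hφ0 x) (hφ1 x) hp0.le
  have hφp0 : ∀ x, 0 ≤ cutoff x₀ ρ h x ^ p := fun x => Real.rpow_nonneg (hφ0 x) p
  refine ⟨⟨?_, ?_⟩, Filter.Eventually.of_forall fun x hx => ?_⟩
  · refine huW.1.mono (by fun_prop : Measurable _).aestronglyMeasurable
      (Filter.Eventually.of_forall fun x => ?_)
    rw [Real.norm_of_nonneg (mul_nonneg (le_max_right _ _) (hφp0 x)), Real.norm_eq_abs]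
    calc _ ≤ |u x| * 1 := by
          exact mul_le_mul (hw x) (hφp1 x) (hφp0 x) (abs_nonneg _)
      _ = _ := mul_one _
  · refine (huW.2.add ((memLp_mul_min_quotient hn hs0 hs1 hp hu (huW.integrable_rpow hp)
      hh).const_mul p)).mono (by fun_prop : Measurable _).aestronglyMeasurable
      (Filter.Eventually.of_forall fun z => ?_)
    have hm : 0 ≤ min 1 (‖z.1 - z.2‖ / h) := le_min zero_le_one (by positivity)
    simp only [Pi.add_apply]
    rw [Real.norm_of_nonneg (by positivity), Real.norm_of_nonneg (by positivity), ← mul_div_assoc,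
      ← add_div]
    gcongr
    have h1 : |max (u z.1 - k) 0 - max (u z.2 - k) 0| ≤ |u z.1 - u z.2| := by
      refine (abs_max_sub_max_le_abs _ _ _).trans ?_
      simp
    have h2 := abs_rpow_sub_rpow_le hp (hφ0 z.1) (hφ1 z.1) (hφ0 z.2) (hφ1 z.2)
    have h3 := h2.trans (mul_le_mul_of_nonneg_left
      (abs_cutoff_sub_le (x₀ := x₀) (ρ := ρ) hh z.1 z.2) hp0.le)
    have e : max (u z.1 - k) 0 * cutoff x₀ ρ h z.1 ^ p - max (u z.2 - k) 0 * cutoff x₀ ρ h z.2 ^ p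
        = (max (u z.1 - k) 0 - max (u z.2 - k) 0) * cutoff x₀ ρ h z.2 ^ p
          + max (u z.1 - k) 0 * (cutoff x₀ ρ h z.1 ^ p - cutoff x₀ ρ h z.2 ^ p) := by ring
    rw [e]
    refine (abs_add_le _ _).trans ?_
    rw [abs_mul, abs_mul, abs_of_nonneg (hφp0 z.2), abs_of_nonneg (le_max_right (u z.1 - k) 0)]
    refine add_le_add ?_ ?_
    · calc _ ≤ |u z.1 - u z.2| * 1 := by
            gcongr
            · exact hφp0 _
            · exact hφp1 _
        _ = _ := mul_one _
    · calc _ ≤ |u z.1| * (p * min 1 (‖z.1 - z.2‖ / h)) := by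
            gcongr
            exact hw _
        _ = _ := by ring
  · have hx' : ρ ≤ ‖x - x₀‖ := by
      by_contra hlt
      exact hx (hΩ (by rw [mem_ball, dist_eq_norm]; exact not_le.1 hlt))
    simp only
    rw [cutoff_eq_zero hh hx', Real.zero_rpow hp0.ne', mul_zero]

lemma IsKernel.ae_bounds {n : ℕ} {s p lam Lam : ℝ} (hp : 1 < p) (hs0 : 0 < s)
    (hlam : 1 ≤ lam) {K : Rn n → Rn n → ℝ}
    (hK : IsKernel s p lam Lam K) : ∀ᵐ z : Rn n × Rn n,
      ‖z.1 - z.2‖ ^ (-((n : ℝ) + s * p)) ≤ K z.1 z.2 ∧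
      K z.1 z.2 ≤ Lam * ‖z.1 - z.2‖ ^ (-((n : ℝ) + s * p)) := by
  filter_upwards [hK.bounds] with z hz
  have hne : (n : ℝ) + s * p ≠ 0 := by
    have : 0 < s * p := by positivity
    have : (0 : ℝ) ≤ n := n.cast_nonneg
    linarith
  rcases (norm_nonneg (z.1 - z.2)).eq_or_lt with h0 | h0
  · rw [← h0, Real.zero_rpow hne, mul_zero] at hz
    linarith [hz.1]
  · have hpos := Real.rpow_pos_of_pos h0 ((n : ℝ) + s * p)
    rw [Real.rpow_neg h0.le]
    constructor
    · rw [inv_le_iff_one_le_mul₀ hpos]; linarith [hz.1]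
    · rw [← div_eq_mul_inv, le_div_iff₀ hpos]; exact hz.2

/-- The integrand of the weak formulation is integrable, so that its Bochner integral is not a
junk value. -/
lemma integrable_weak_integrand {n : ℕ} {s p lam Lam : ℝ} (hp : 1 < p) (hs0 : 0 < s)
    (hlam : 1 ≤ lam) (hLam : lam ≤ Lam) {K : Rn n → Rn n → ℝ} (hK : IsKernel s p lam Lam K)
    {u η : Rn n → ℝ} (hu : Measurable u) (hη : Measurable η) (huW : MemWsp s p u)
    (hηW : MemWsp s p η) :
    Integrable (fun z : Rn n × Rn n =>
      K z.1 z.2 * |u z.1 - u z.2| ^ (p - 2) * (u z.1 - u z.2) * (η z.1 - η z.2)) volume := by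
  have hm : Measurable fun z : Rn n × Rn n =>
      |u z.1 - u z.2| ^ (p - 2) * (u z.1 - u z.2) * (η z.1 - η z.2) := by fun_prop
  refine Integrable.mono' (((huW.integrable_quotient_rpow hp).add
    (hηW.integrable_quotient_rpow hp)).const_mul Lam) ?_ ?_
  · refine ((hK.aemeasurable.mul hm.aemeasurable).aestronglyMeasurable).congr
      (Filter.Eventually.of_forall fun z => ?_)
    simp only [Pi.mul_apply]; ring
  · filter_upwards [hK.ae_bounds hp hs0 hlam] with z hz
    have hflux : ∀ t : ℝ, |(|t| ^ (p - 2) * t)| = |t| ^ (p - 1) := by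
      intro t
      rw [abs_mul, abs_of_nonneg (by positivity)]
      have := flux_of_nonneg hp (abs_nonneg t)
      rwa [flux, abs_abs] at this
    have e : K z.1 z.2 * |u z.1 - u z.2| ^ (p - 2) * (u z.1 - u z.2) * (η z.1 - η z.2)
        = K z.1 z.2 * (|u z.1 - u z.2| ^ (p - 2) * (u z.1 - u z.2)) * (η z.1 - η z.2) := by ring
    rw [e, Real.norm_eq_abs, abs_mul, abs_mul, hflux, abs_of_nonneg (hK.nonneg _ _)]
    simp only [Pi.add_apply]
    have hLam0 : 0 ≤ Lam := by linarith
    have hy := rpow_sub_one_mul_le hp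
      (a := |u z.1 - u z.2| / ‖z.1 - z.2‖ ^ ((n : ℝ) / p + s))
      (b := |η z.1 - η z.2| / ‖z.1 - z.2‖ ^ ((n : ℝ) / p + s)) (by positivity) (by positivity)
    refine le_trans ?_ (mul_le_mul_of_nonneg_left hy hLam0)
    have e2 : Lam * ((|u z.1 - u z.2| / ‖z.1 - z.2‖ ^ ((n : ℝ) / p + s)) ^ (p - 1)
          * (|η z.1 - η z.2| / ‖z.1 - z.2‖ ^ ((n : ℝ) / p + s)))
        = Lam * ‖z.1 - z.2‖ ^ (-((n : ℝ) + s * p)) * |u z.1 - u z.2| ^ (p - 1)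
          * |η z.1 - η z.2| := by
      rw [Real.div_rpow (abs_nonneg _) (by positivity), Real.rpow_neg (norm_nonneg _),
        ← rpow_div_add_rpow hp (norm_nonneg _),
        ← rpow_sub_one_mul_self hp (Real.rpow_nonneg (norm_nonneg (z.1 - z.2)) _), mul_inv]
      ring
    rw [e2]
    gcongr
    exact hz.2

/-! ### The energy estimate -/

/-- Passing from the weak inequality, a Bochner integral, to a comparison of lower integrals. No
integrability of the majorant `N` is needed. -/
lemma lintegral_le_of_integral_nonpos {α : Type*} [MeasurableSpace α] {μ : Measure α}
    {F P N : α → ℝ} (hF : Integrable F μ) (hF0 : ∫ x, F x ∂μ ≤ 0)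
    (hP : ∀ x, 0 ≤ P x) (h : ∀ᵐ x ∂μ, P x ≤ F x + N x) :
    ∫⁻ x, ENNReal.ofReal (P x) ∂μ ≤ ∫⁻ x, ENNReal.ofReal (N x) ∂μ := by
  have hfin : ∫⁻ x, ENNReal.ofReal (-F x) ∂μ ≠ ⊤ := hF.neg.lintegral_lt_top.ne
  have hfin' : ∫⁻ x, ENNReal.ofReal (F x) ∂μ ≠ ⊤ := hF.lintegral_lt_top.ne
  have h1 : ∫⁻ x, ENNReal.ofReal (F x) ∂μ ≤ ∫⁻ x, ENNReal.ofReal (-F x) ∂μ := by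
    rw [integral_eq_lintegral_pos_part_sub_lintegral_neg_part hF, sub_nonpos] at hF0
    exact (ENNReal.toReal_le_toReal hfin' hfin).1 hF0
  have h2 : ∫⁻ x, ENNReal.ofReal (P x) ∂μ + ∫⁻ x, ENNReal.ofReal (-F x) ∂μ
      ≤ ∫⁻ x, ENNReal.ofReal (N x) ∂μ + ∫⁻ x, ENNReal.ofReal (F x) ∂μ := by
    have ha : AEMeasurable (fun x => ENNReal.ofReal (F x)) μ := hF.aemeasurable.ennreal_ofReal
    have hb : AEMeasurable (fun x => ENNReal.ofReal (-F x)) μ := hF.aemeasurable.neg.ennreal_ofReal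
    rw [← lintegral_add_right' _ ha, ← lintegral_add_right' _ hb]
    refine lintegral_mono_ae ?_
    filter_upwards [h] with x hx
    rcases le_total 0 (F x) with h0 | h0
    · rw [ENNReal.ofReal_of_nonpos (neg_nonpos.2 h0), add_zero, add_comm (ENNReal.ofReal (N x))]
      exact (ENNReal.ofReal_le_ofReal hx).trans ENNReal.ofReal_add_le
    · rw [ENNReal.ofReal_of_nonpos h0, add_zero, ← ENNReal.ofReal_add (hP x) (neg_nonneg.2 h0)]
      exact ENNReal.ofReal_le_ofReal (by linarith)
  exact (ENNReal.add_le_add_iff_right hfin).1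
    (h2.trans (by gcongr))

lemma ofReal_indicator {α : Type*} (S : Set α) (f : α → ℝ) (x : α) :
    ENNReal.ofReal (S.indicator f x) = S.indicator (fun x => ENNReal.ofReal (f x)) x := by
  by_cases hx : x ∈ S <;> simp [hx]

/-- One half of the integrand on the right-hand side of the energy estimate at level `k` in
`B_ρ(x₀)`; its first term stems from the cutoff, its second from the interaction with the
complement of the ball. -/
noncomputable def energyMajorant {n : ℕ} (s p : ℝ) (u : Rn n → ℝ) (k : ℝ) (x₀ : Rn n) (ρ h : ℝ)
    (z : Rn n × Rn n) : ℝ :=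
  (ball x₀ ρ).indicator (fun x => p ^ p * max (u x - k) 0 ^ p) z.1 *
      (min 1 (‖z.1 - z.2‖ / h) ^ p * ‖z.1 - z.2‖ ^ (-((n : ℝ) + s * p)))
    + (ball x₀ ρ).indicator (fun x => max (u x - k) 0) z.1 * ((ρ / h) ^ ((n : ℝ) + s * p)
      * (ball x₀ ρ)ᶜ.indicator
        (fun y => max (u y - k) 0 ^ (p - 1) * ‖y - x₀‖ ^ (-((n : ℝ) + s * p))) z.2)

section

variable {n : ℕ} {s p : ℝ} {u : Rn n → ℝ} {k : ℝ} {x₀ : Rn n} {ρ h : ℝ}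

lemma energyMajorant_nonneg (hp : 1 < p) (hh : 0 < h) (hρ : 0 < ρ) (z : Rn n × Rn n) :
    0 ≤ energyMajorant s p u k x₀ ρ h z := by
  have hm : 0 ≤ min 1 (‖z.1 - z.2‖ / h) := le_min zero_le_one (by positivity)
  have hp0 : 0 < p := by linarith
  have h1 : 0 ≤ (ball x₀ ρ).indicator (fun x => p ^ p * max (u x - k) 0 ^ p) z.1 :=
    Set.indicator_nonneg (fun x _ => by positivity) _
  have h2 : 0 ≤ (ball x₀ ρ).indicator (fun x => max (u x - k) 0) z.1 :=
    Set.indicator_nonneg (fun x _ => by positivity) _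
  have h3 : 0 ≤ (ball x₀ ρ)ᶜ.indicator
        (fun y => max (u y - k) 0 ^ (p - 1) * ‖y - x₀‖ ^ (-((n : ℝ) + s * p))) z.2 :=
    Set.indicator_nonneg (fun x _ => by positivity) _
  unfold energyMajorant
  positivity

lemma kernel_le_of_mem_support (hsp : 0 < s * p) (hh : 0 < h) (hhρ : h < ρ) {x y : Rn n}
    (hx : ‖x - x₀‖ ≤ ρ - h) (hy : ρ ≤ ‖y - x₀‖) :
    ‖x - y‖ ^ (-((n : ℝ) + s * p))
      ≤ (ρ / h) ^ ((n : ℝ) + s * p) * ‖y - x₀‖ ^ (-((n : ℝ) + s * p)) := by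
  have hρ : 0 < ρ := hh.trans hhρ
  have hy0 : 0 < ‖y - x₀‖ := hρ.trans_le hy
  have hn : (0 : ℝ) ≤ n := n.cast_nonneg
  have h1 : h / ρ * ‖y - x₀‖ ≤ ‖x - y‖ := by
    have h2 : ‖y - x₀‖ ≤ ‖x - x₀‖ + ‖x - y‖ := by
      have := norm_sub_le (x - x₀) (x - y)
      rwa [sub_sub_sub_cancel_left] at this
    have h3 : (ρ - h) / ρ * ρ ≤ (ρ - h) / ρ * ‖y - x₀‖ :=
      mul_le_mul_of_nonneg_left hy (div_nonneg (by linarith) hρ.le)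
    have h4 : (ρ - h) / ρ = 1 - h / ρ := by field_simp
    rw [div_mul_cancel₀ _ hρ.ne', h4] at h3
    linarith
  have h5 : (ρ / h) ^ ((n : ℝ) + s * p) = (h / ρ) ^ (-((n : ℝ) + s * p)) := by
    rw [Real.rpow_neg (by positivity), ← Real.inv_rpow (by positivity), inv_div]
  rw [h5, ← Real.mul_rpow (by positivity) hy0.le]
  exact Real.rpow_le_rpow_of_nonpos (by positivity) h1 (by linarith)

/-- The pointwise inequality behind the energy estimate: the crossing pairs are controlled by the
integrand of the weak formulation with test function `(u - k)₊ φ^p`, up to the majorant. -/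
lemma crossing_le_integrand_add_majorant {Lam κ : ℝ} (hp : 1 < p) (hs0 : 0 < s) (hh : 0 < h)
    (hhρ : h < ρ) (hLam : 0 ≤ Lam) (x y : Rn n)
    (hκ1 : ‖x - y‖ ^ (-((n : ℝ) + s * p)) ≤ κ)
    (hκ2 : κ ≤ Lam * ‖x - y‖ ^ (-((n : ℝ) + s * p))) :
    (if k < u x ∧ u y ≤ k then max (u x - k) 0 ^ p * cutoff x₀ (ρ - h) h x ^ p else 0)
        * ‖x - y‖ ^ (-((n : ℝ) + s * p))
      ≤ κ * |u x - u y| ^ (p - 2) * (u x - u y)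
          * (max (u x - k) 0 * cutoff x₀ (ρ - h) h x ^ p
            - max (u y - k) 0 * cutoff x₀ (ρ - h) h y ^ p)
        + Lam * (energyMajorant s p u k x₀ ρ h (x, y) + energyMajorant s p u k x₀ ρ h (y, x)) := by
  have hp0 : 0 < p := by linarith
  set φ := cutoff x₀ (ρ - h) h with hφ
  have hφ0 : ∀ x, 0 ≤ φ x := cutoff_nonneg
  set J := ‖x - y‖ ^ (-((n : ℝ) + s * p)) with hJ
  have hJ0 : 0 ≤ J := by positivity
  have hκ0 : 0 ≤ κ := hJ0.trans hκ1
  set P := (if k < u x ∧ u y ≤ k then max (u x - k) 0 ^ p * φ x ^ p else 0) with hP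
  have hP0 : 0 ≤ P := by
    have := hφ0 x
    rw [hP]; split_ifs <;> positivity
  set G := flux p (u x - u y) * (max (u x - k) 0 * φ x ^ p - max (u y - k) 0 * φ y ^ p) with hG
  have hKG : κ * |u x - u y| ^ (p - 2) * (u x - u y)
          * (max (u x - k) 0 * φ x ^ p - max (u y - k) 0 * φ y ^ p) = κ * G := by
    rw [hG, flux]; ring
  rw [hKG]
  -- It suffices to bound the pointwise error `E`, weighted with the model kernel.
  suffices hE : ∃ E, 0 ≤ E ∧ P ≤ G + E ∧ E * J ≤ energyMajorant s p u k x₀ ρ h (x, y)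
      + energyMajorant s p u k x₀ ρ h (y, x) by
    obtain ⟨E, hE0, hE1, hE2⟩ := hE
    have a1 := mul_le_mul_of_nonneg_left hκ1 hP0
    have a2 := mul_le_mul_of_nonneg_left hE1 hκ0
    have a3 := mul_le_mul_of_nonneg_right hκ2 hE0
    have a4 := mul_le_mul_of_nonneg_left hE2 hLam
    nlinarith
  have hJ' : ‖y - x‖ ^ (-((n : ℝ) + s * p)) = J := by rw [norm_sub_rev]
  have hball : ∀ {t : Rn n}, t ∉ ball x₀ ρ → ρ ≤ ‖t - x₀‖ := fun {t} ht => by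
    simpa [dist_eq_norm] using ht
  have hout : ∀ {t : Rn n}, t ∉ ball x₀ ρ → φ t = 0 := fun {t} ht =>
    cutoff_eq_zero hh (by linarith [hball ht])
  have hfar : ∀ a b : Rn n, b ∉ ball x₀ ρ →
      max (u a - k) 0 * φ a ^ p * ‖a - b‖ ^ (-((n : ℝ) + s * p))
        ≤ max (u a - k) 0 * ((ρ / h) ^ ((n : ℝ) + s * p) * ‖b - x₀‖ ^ (-((n : ℝ) + s * p))) := by
    intro a b hb
    have hρ : 0 < ρ := hh.trans hhρ
    rcases le_or_gt (ρ - h) ‖a - x₀‖ with ha | ha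
    · rw [show φ a = 0 from cutoff_eq_zero hh ha, Real.zero_rpow hp0.ne', mul_zero, zero_mul]
      positivity
    · rw [mul_assoc]
      refine mul_le_mul_of_nonneg_left ?_ (le_max_right _ _)
      calc _ ≤ 1 * ‖a - b‖ ^ (-((n : ℝ) + s * p)) := by
            gcongr
            exact Real.rpow_le_one (hφ0 a) (cutoff_le_one a) hp0.le
        _ ≤ _ := by
            rw [one_mul]; exact kernel_le_of_mem_support (mul_pos hs0 hp0) hh hhρ ha.le (hball hb)
  by_cases hx : x ∈ ball x₀ ρ <;> by_cases hy : y ∈ ball x₀ ρ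
  · refine ⟨p ^ p * (max (u x - k) 0 ^ p + max (u y - k) 0 ^ p) * |φ x - φ y| ^ p,
      by positivity, flux_truncation_ge hp (hφ0 x) (hφ0 y), ?_⟩
    simp only [energyMajorant, Set.indicator_of_mem hx, Set.indicator_of_mem hy,
      Set.indicator_of_notMem (Set.notMem_compl_iff.2 hx),
      Set.indicator_of_notMem (Set.notMem_compl_iff.2 hy), mul_zero, add_zero,
      norm_sub_rev y x]
    have h1 : |φ x - φ y| ^ p ≤ min 1 (‖x - y‖ / h) ^ p :=
      Real.rpow_le_rpow (abs_nonneg _) (abs_cutoff_sub_le hh x y) hp0.le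
    have h2 : 0 ≤ p ^ p * (max (u x - k) 0 ^ p + max (u y - k) 0 ^ p) := by positivity
    have h3 := mul_le_mul_of_nonneg_right (mul_le_mul_of_nonneg_left h1 h2) hJ0
    rw [← hJ]
    nlinarith
  · refine ⟨max (u y - k) 0 ^ (p - 1) * (max (u x - k) 0 * φ x ^ p), ?_, ?_, ?_⟩
    · have := hφ0 x; positivity
    · rw [hG, hout hy, Real.zero_rpow hp0.ne', mul_zero, sub_zero]
      exact flux_truncation_ge_far hp (hφ0 x)
    · refine le_add_of_le_of_nonneg ?_ (energyMajorant_nonneg hp hh (hh.trans hhρ) _)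
      simp only [energyMajorant, Set.indicator_of_mem hx,
        Set.indicator_of_mem (Set.mem_compl hy)]
      refine le_add_of_nonneg_of_le ?_ ?_
      · have hm : 0 ≤ min 1 (‖x - y‖ / h) := le_min zero_le_one (by positivity)
        positivity
      · have h1 := mul_le_mul_of_nonneg_left (hfar x y hy)
          (by positivity : 0 ≤ max (u y - k) 0 ^ (p - 1))
        rw [← hJ] at h1
        nlinarith
  · have hPz : P = 0 := by
      rw [hP]; split_ifs
      · rw [hout hx, Real.zero_rpow hp0.ne', mul_zero]
      · rfl
    refine ⟨max (u x - k) 0 ^ (p - 1) * (max (u y - k) 0 * φ y ^ p), ?_, ?_, ?_⟩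
    · have := hφ0 y; positivity
    · rw [hPz, hG, hout hx, Real.zero_rpow hp0.ne', mul_zero, zero_sub, mul_neg]
      have h1 := flux_truncation_ge_far (a := u y) (b := u x) (k := k) hp (hφ0 y)
      have h2 : flux p (u y - u x) = -flux p (u x - u y) := by rw [← flux_neg, neg_sub]
      rw [h2] at h1
      refine le_trans ?_ (h1.trans (le_of_eq (by ring)))
      have := hφ0 y
      split_ifs <;> positivity
    · refine le_add_of_nonneg_of_le (energyMajorant_nonneg hp hh (hh.trans hhρ) _) ?_
      simp only [energyMajorant, Set.indicator_of_mem hy,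
        Set.indicator_of_mem (Set.mem_compl hx)]
      refine le_add_of_nonneg_of_le ?_ ?_
      · have hm : 0 ≤ min 1 (‖y - x‖ / h) := le_min zero_le_one (by positivity)
        positivity
      · have h1 := mul_le_mul_of_nonneg_left (hfar y x hx)
          (by positivity : 0 ≤ max (u x - k) 0 ^ (p - 1))
        rw [hJ'] at h1
        nlinarith
  · refine ⟨0, le_rfl, ?_, ?_⟩
    · have hPz : P = 0 := by
        rw [hP]; split_ifs
        · rw [hout hx, Real.zero_rpow hp0.ne', mul_zero]
        · rfl
      rw [hPz, hG, hout hx, hout hy, Real.zero_rpow hp0.ne']; simp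
    · rw [zero_mul]
      exact add_nonneg (energyMajorant_nonneg hp hh (hh.trans hhρ) _)
        (energyMajorant_nonneg hp hh (hh.trans hhρ) _)

lemma lintegral_energyMajorant_le (hp : 1 < p) (hh : 0 < h) (hρ : 0 < ρ) (hu : Measurable u)
    {D : ENNReal} (hD : ∀ x : Rn n,
      ∫⁻ y, ENNReal.ofReal (min 1 (‖x - y‖ / h) ^ p * ‖x - y‖ ^ (-((n : ℝ) + s * p))) ≤ D) :
    ∫⁻ z, ENNReal.ofReal (energyMajorant s p u k x₀ ρ h z)
      ≤ (∫⁻ x in ball x₀ ρ, ENNReal.ofReal (p ^ p * max (u x - k) 0 ^ p)) * D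
        + (∫⁻ x in ball x₀ ρ, ENNReal.ofReal (max (u x - k) 0))
          * (ENNReal.ofReal ((ρ / h) ^ ((n : ℝ) + s * p)) * ∫⁻ y in (ball x₀ ρ)ᶜ,
            ENNReal.ofReal (max (u y - k) 0 ^ (p - 1) * ‖y - x₀‖ ^ (-((n : ℝ) + s * p)))) := by
  have hp0 : 0 < p := by linarith
  have e : ∀ z : Rn n × Rn n, ENNReal.ofReal (energyMajorant s p u k x₀ ρ h z)
      = (ball x₀ ρ).indicator (fun x => ENNReal.ofReal (p ^ p * max (u x - k) 0 ^ p)) z.1 *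
        ENNReal.ofReal (min 1 (‖z.1 - z.2‖ / h) ^ p * ‖z.1 - z.2‖ ^ (-((n : ℝ) + s * p)))
      + (ball x₀ ρ).indicator (fun x => ENNReal.ofReal (max (u x - k) 0)) z.1 *
        (ENNReal.ofReal ((ρ / h) ^ ((n : ℝ) + s * p)) * (ball x₀ ρ)ᶜ.indicator (fun y =>
          ENNReal.ofReal (max (u y - k) 0 ^ (p - 1) * ‖y - x₀‖ ^ (-((n : ℝ) + s * p)))) z.2) := by
    intro z
    have hm : 0 ≤ min 1 (‖z.1 - z.2‖ / h) := le_min zero_le_one (by positivity)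
    have h1 : 0 ≤ (ball x₀ ρ).indicator (fun x => p ^ p * max (u x - k) 0 ^ p) z.1 :=
      Set.indicator_nonneg (fun x _ => by positivity) _
    have h2 : 0 ≤ (ball x₀ ρ).indicator (fun x => max (u x - k) 0) z.1 :=
      Set.indicator_nonneg (fun x _ => by positivity) _
    have h3 : 0 ≤ (ball x₀ ρ)ᶜ.indicator
        (fun y => max (u y - k) 0 ^ (p - 1) * ‖y - x₀‖ ^ (-((n : ℝ) + s * p))) z.2 :=
      Set.indicator_nonneg (fun x _ => by positivity) _
    rw [energyMajorant, ENNReal.ofReal_add (by positivity) (by positivity),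
      ENNReal.ofReal_mul h1, ENNReal.ofReal_mul h2,
      ENNReal.ofReal_mul (p := (ρ / h) ^ ((n : ℝ) + s * p)) (by positivity),
      ofReal_indicator, ofReal_indicator, ofReal_indicator]
  have hB : MeasurableSet (ball x₀ ρ) := measurableSet_ball
  have m1 : Measurable ((ball x₀ ρ).indicator
      (fun x => ENNReal.ofReal (p ^ p * max (u x - k) 0 ^ p))) :=
    (by fun_prop : Measurable _).indicator hB
  have m2 : Measurable ((ball x₀ ρ).indicator (fun x => ENNReal.ofReal (max (u x - k) 0))) :=
    (by fun_prop : Measurable _).indicator hB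
  have m3 : Measurable ((ball x₀ ρ)ᶜ.indicator (fun y =>
      ENNReal.ofReal (max (u y - k) 0 ^ (p - 1) * ‖y - x₀‖ ^ (-((n : ℝ) + s * p))))) :=
    (by fun_prop : Measurable _).indicator hB.compl
  simp_rw [e]
  rw [lintegral_add_left (by fun_prop), Measure.volume_eq_prod,
    lintegral_prod _ (by fun_prop : Measurable _).aemeasurable,
    lintegral_prod _ (by fun_prop : Measurable _).aemeasurable]
  gcongr
  · rw [← lintegral_indicator hB, ← lintegral_mul_const _ m1]
    refine lintegral_mono fun x => ?_
    simp only
    rw [lintegral_const_mul _ (by fun_prop)]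
    gcongr
    exact hD x
  · simp only
    rw [← lintegral_indicator hB, ← lintegral_indicator hB.compl, ← lintegral_const_mul _ m3,
      ← lintegral_mul_const _ m2]
    refine lintegral_mono fun x => ?_
    rw [lintegral_const_mul _ (by fun_prop)]

/-- The energy (Caccioppoli) estimate at level `k`. The left-hand side only retains the pairs of
points on different sides of the level. -/
lemma lintegral_crossing_le {lam Lam : ℝ} (hn : 1 ≤ n) (hs0 : 0 < s) (hs1 : s < 1) (hp : 1 < p)
    (hlam : 1 ≤ lam) (hLam : lam ≤ Lam) {K : Rn n → Rn n → ℝ} (hK : IsKernel s p lam Lam K)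
    {Ω : Set (Rn n)} (hu : Measurable u) (huW : MemWsp s p u)
    (hweak : ∀ η : Rn n → ℝ, MemWspZero s p Ω η → (∀ᵐ x : Rn n, 0 ≤ η x) →
      ∫ z : Rn n × Rn n,
        K z.1 z.2 * |u z.1 - u z.2| ^ (p - 2) * (u z.1 - u z.2) * (η z.1 - η z.2) ≤ 0)
    (hk : 0 ≤ k) (hh : 0 < h) (hhρ : h < ρ) (hΩ : ball x₀ ρ ⊆ Ω)
    {D : ENNReal} (hD : ∀ x : Rn n,
      ∫⁻ y, ENNReal.ofReal (min 1 (‖x - y‖ / h) ^ p * ‖x - y‖ ^ (-((n : ℝ) + s * p))) ≤ D) :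
    ∫⁻ x in {x | k < u x}, ENNReal.ofReal (max (u x - k) 0 ^ p * cutoff x₀ (ρ - h) h x ^ p)
        * ∫⁻ y in {y | u y ≤ k}, ENNReal.ofReal (‖x - y‖ ^ (-((n : ℝ) + s * p)))
      ≤ ENNReal.ofReal (2 * Lam) *
        ((∫⁻ x in ball x₀ ρ, ENNReal.ofReal (p ^ p * max (u x - k) 0 ^ p)) * D
        + (∫⁻ x in ball x₀ ρ, ENNReal.ofReal (max (u x - k) 0))
          * (ENNReal.ofReal ((ρ / h) ^ ((n : ℝ) + s * p)) * ∫⁻ y in (ball x₀ ρ)ᶜ,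
            ENNReal.ofReal (max (u y - k) 0 ^ (p - 1) * ‖y - x₀‖ ^ (-((n : ℝ) + s * p))))) := by
  have hp0 : 0 < p := by linarith
  have hLam0 : 0 ≤ Lam := by linarith
  have hρ : 0 < ρ := hh.trans hhρ
  have hφ0 : ∀ x, 0 ≤ cutoff x₀ (ρ - h) h x := cutoff_nonneg
  have hη : MemWspZero s p Ω (fun x => max (u x - k) 0 * cutoff x₀ (ρ - h) h x ^ p) :=
    memWspZero_truncation_mul_cutoff hn hs0 hs1 hp hu huW hk hh
      ((ball_subset_ball (by linarith)).trans hΩ)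
  have hη0 : ∀ x, 0 ≤ max (u x - k) 0 * cutoff x₀ (ρ - h) h x ^ p := fun x => by
    have := hφ0 x; positivity
  have hint := integrable_weak_integrand hp hs0 hlam hLam hK hu (by fun_prop) huW hη.1
  have hA : MeasurableSet {x | k < u x} := measurableSet_lt measurable_const hu
  have hA' : MeasurableSet {x | u x ≤ k} := measurableSet_le hu measurable_const
  set P : Rn n × Rn n → ℝ := fun z =>
    (if k < u z.1 ∧ u z.2 ≤ k then max (u z.1 - k) 0 ^ p * cutoff x₀ (ρ - h) h z.1 ^ p else 0)
        * ‖z.1 - z.2‖ ^ (-((n : ℝ) + s * p)) with hP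
  have hP0 : ∀ z, 0 ≤ P z := fun z => by
    have := hφ0 z.1
    simp only [hP]; split_ifs <;> positivity
  set M := energyMajorant s p u k x₀ ρ h with hM
  have hMm : Measurable M := by
    rw [hM]; unfold energyMajorant
    refine Measurable.add (Measurable.mul ?_ (by fun_prop)) (Measurable.mul ?_
      (Measurable.mul measurable_const ?_))
    · exact ((by fun_prop : Measurable _).indicator measurableSet_ball).comp measurable_fst
    · exact ((by fun_prop : Measurable _).indicator measurableSet_ball).comp measurable_fst
    · exact ((by fun_prop : Measurable _).indicator measurableSet_ball.compl).comp measurable_snd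
  have key := lintegral_le_of_integral_nonpos (P := P)
    (N := fun z => Lam * (M z + M z.swap)) hint
    (hweak _ hη (Filter.Eventually.of_forall hη0)) hP0 (by
      filter_upwards [hK.ae_bounds hp hs0 hlam] with z hz
      exact crossing_le_integrand_add_majorant hp hs0 hh hhρ hLam0 z.1 z.2 hz.1 hz.2)
  have hL : ∫⁻ z, ENNReal.ofReal (P z) = ∫⁻ x in {x | k < u x},
      ENNReal.ofReal (max (u x - k) 0 ^ p * cutoff x₀ (ρ - h) h x ^ p)
        * ∫⁻ y in {y | u y ≤ k}, ENNReal.ofReal (‖x - y‖ ^ (-((n : ℝ) + s * p))) := by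
    have e : ∀ z, ENNReal.ofReal (P z) = {x | k < u x}.indicator (fun x =>
        ENNReal.ofReal (max (u x - k) 0 ^ p * cutoff x₀ (ρ - h) h x ^ p)) z.1
        * {y | u y ≤ k}.indicator
          (fun y => ENNReal.ofReal (‖z.1 - y‖ ^ (-((n : ℝ) + s * p)))) z.2 := by
      intro z
      have := hφ0 z.1
      by_cases h1 : k < u z.1 <;> by_cases h2 : u z.2 ≤ k
      · simp only [hP, h1, h2, and_self, if_true, Set.indicator, Set.mem_ofPred_eq]
        rw [ENNReal.ofReal_mul (by positivity)]
      all_goals simp [hP, h1, h2]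
    have hPm : Measurable P := by
      simp only [hP]
      refine Measurable.mul (Measurable.ite ?_ (by fun_prop) measurable_const) (by fun_prop)
      exact (measurable_fst hA).inter (measurable_snd hA')
    rw [Measure.volume_eq_prod, lintegral_prod _ hPm.ennreal_ofReal.aemeasurable,
      ← lintegral_indicator hA]
    refine lintegral_congr fun x => ?_
    simp_rw [e]
    rw [lintegral_const_mul _ ((by fun_prop : Measurable _).indicator hA'),
      lintegral_indicator hA']
    by_cases h1 : k < u x <;> simp [h1]
  have hR : ∫⁻ z, ENNReal.ofReal (Lam * (M z + M z.swap))
      = ENNReal.ofReal (2 * Lam) * ∫⁻ z, ENNReal.ofReal (M z) := by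
    have hM0 : ∀ z, 0 ≤ M z := energyMajorant_nonneg hp hh hρ
    simp_rw [ENNReal.ofReal_mul hLam0, fun z : Rn n × Rn n =>
      ENNReal.ofReal_add (hM0 z) (hM0 z.swap)]
    rw [lintegral_const_mul _ (by fun_prop), lintegral_add_left (by fun_prop)]
    have : ∫⁻ z : Rn n × Rn n, ENNReal.ofReal (M z.swap) = ∫⁻ z, ENNReal.ofReal (M z) := by
      rw [Measure.volume_eq_prod]
      exact lintegral_prod_swap (fun z => ENNReal.ofReal (M z))
    rw [this, mul_comm 2 Lam, ENNReal.ofReal_mul hLam0, ENNReal.ofReal_ofNat, mul_assoc, two_mul]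
  rw [hL, hR] at key
  exact key.trans (mul_le_mul_right (lintegral_energyMajorant_le hp hh hρ hu hD) _)

end

/-! ### One step of the iteration -/

/-- The integral of `(u - k)₊^p` over `B_ρ(x₀)`, the quantity iterated in the De Giorgi scheme. -/
noncomputable def levelEnergy {n : ℕ} (p : ℝ) (u : Rn n → ℝ) (x₀ : Rn n) (k ρ : ℝ) : ℝ :=
  ∫ x in ball x₀ ρ, max (u x - k) 0 ^ p

section

variable {n : ℕ} {s p : ℝ} {u : Rn n → ℝ} {k k' : ℝ} {x₀ : Rn n} {ρ ρ' h r : ℝ}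

lemma levelEnergy_nonneg : 0 ≤ levelEnergy p u x₀ k ρ :=
  setIntegral_nonneg measurableSet_ball fun x _ => by positivity

lemma integrable_truncation_rpow (hp : 1 < p) (hu : Measurable u)
    (hup : Integrable (fun x => |u x| ^ p) volume) (hk : 0 ≤ k) :
    Integrable (fun x => max (u x - k) 0 ^ p) volume := by
  refine hup.mono' (by fun_prop : Measurable _).aestronglyMeasurable
    (Filter.Eventually.of_forall fun x => ?_)
  rw [Real.norm_of_nonneg (by positivity)]
  exact Real.rpow_le_rpow (le_max_right _ _)
    (max_le (by linarith [le_abs_self (u x)]) (abs_nonneg _)) (by linarith)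

lemma lintegral_truncation_rpow (hp : 1 < p) (hu : Measurable u)
    (hup : Integrable (fun x => |u x| ^ p) volume) (hk : 0 ≤ k) :
    ∫⁻ x in ball x₀ ρ, ENNReal.ofReal (max (u x - k) 0 ^ p)
      = ENNReal.ofReal (levelEnergy p u x₀ k ρ) := by
  rw [levelEnergy, ofReal_integral_eq_lintegral_ofReal
    (integrable_truncation_rpow hp hu hup hk).integrableOn
    (Filter.Eventually.of_forall fun x => by simp only [Pi.zero_apply]; positivity)]

lemma levelEnergy_mono (hp : 1 < p) (hu : Measurable u)
    (hup : Integrable (fun x => |u x| ^ p) volume) (hk' : 0 ≤ k') (hkk : k' ≤ k) (hρ : ρ' ≤ ρ) :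
    levelEnergy p u x₀ k ρ' ≤ levelEnergy p u x₀ k' ρ := by
  have h1 := integrable_truncation_rpow hp hu hup hk'
  have h2 := integrable_truncation_rpow hp hu hup (hk'.trans hkk)
  calc levelEnergy p u x₀ k ρ' ≤ levelEnergy p u x₀ k ρ :=
        setIntegral_mono_set h2.integrableOn
          (Filter.Eventually.of_forall fun x => by simp only [Pi.zero_apply]; positivity)
          (ball_subset_ball hρ).eventuallyLE
    _ ≤ _ := by
        refine setIntegral_mono h2.integrableOn h1.integrableOn fun x => ?_
        exact Real.rpow_le_rpow (le_max_right _ _) (max_le_max (by linarith) le_rfl) (by linarith)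

lemma volume_superlevel_le (hp : 1 < p) (hu : Measurable u)
    (hup : Integrable (fun x => |u x| ^ p) volume) (hk' : 0 ≤ k') (hkk : k' < k) :
    volume (ball x₀ ρ ∩ {x | k < u x})
      ≤ ENNReal.ofReal (levelEnergy p u x₀ k' ρ / (k - k') ^ p) := by
  have hd : 0 < (k - k') ^ p := Real.rpow_pos_of_pos (by linarith) p
  rw [ENNReal.ofReal_div_of_pos hd, ENNReal.le_div_iff_mul_le
    (Or.inl (by simpa using hd)) (Or.inl ENNReal.ofReal_ne_top), mul_comm, ← setLIntegral_const,
    ← lintegral_truncation_rpow hp hu hup hk']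
  refine le_trans (setLIntegral_mono' (measurableSet_ball.inter
    (measurableSet_lt measurable_const hu)) fun x hx => ?_)
    (lintegral_mono_set Set.inter_subset_left)
  refine ENNReal.ofReal_le_ofReal (Real.rpow_le_rpow (by linarith) ?_ (by linarith))
  have : k < u x := hx.2
  exact le_max_of_le_left (by linarith)

/-- The energy estimate combined with the kernel bound of `le_lintegral_kernel_of_half`, at a scale
`R` for which the superlevel set fills at most half of each ball `B_R(x)`. -/
lemma levelEnergy_mul_le {lam Lam C M R : ℝ} (hn : 1 ≤ n) (hs0 : 0 < s) (hs1 : s < 1)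
    (hp : 1 < p) (hlam : 1 ≤ lam) (hLam : lam ≤ Lam) {K : Rn n → Rn n → ℝ}
    (hK : IsKernel s p lam Lam K) {Ω : Set (Rn n)} (hu : Measurable u) (huW : MemWsp s p u)
    (hweak : ∀ η : Rn n → ℝ, MemWspZero s p Ω η → (∀ᵐ x : Rn n, 0 ≤ η x) →
      ∫ z : Rn n × Rn n,
        K z.1 z.2 * |u z.1 - u z.2| ^ (p - 2) * (u z.1 - u z.2) * (η z.1 - η z.2) ≤ 0)
    (hC : 0 ≤ C)
    (hker : ∀ h : ℝ, 0 < h → ∀ x : Rn n,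
      ∫⁻ y, ENNReal.ofReal (min 1 (‖x - y‖ / h) ^ p * ‖x - y‖ ^ (-((n : ℝ) + s * p)))
        ≤ ENNReal.ofReal (C * h ^ (-(s * p))))
    (hk' : 0 ≤ k') (hkk : k' < k) (hh : 0 < h) (hr : 0 < r) (hrρ : r / 2 ≤ ρ - 2 * h)
    (hΩ : ball x₀ ρ ⊆ Ω) (hR : 0 < R) (hRh : R ≤ h)
    (hM : levelEnergy p u x₀ k' ρ / (k - k') ^ p = M)
    (hMR : volume (ball (0 : Rn n) R) = ENNReal.ofReal (2 * M)) :
    R ^ (-((n : ℝ) + s * p)) * M * levelEnergy p u x₀ k (ρ - 2 * h)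
      ≤ 2 * Lam * (p ^ p * C * h ^ (-(s * p))
        + (k - k') ^ (1 - p) * ((ρ / h) ^ ((n : ℝ) + s * p)
          * ∫ x in (ball x₀ (r / 2))ᶜ,
              |max (u x) 0| ^ (p - 1) * ‖x - x₀‖ ^ (-((n : ℝ) + s * p))))
          * levelEnergy p u x₀ k' ρ := by
  have hp0 : 0 < p := by linarith
  have hk : 0 ≤ k := hk'.trans hkk.le
  have hhρ : h < ρ := by linarith
  have hρ : 0 < ρ := hh.trans hhρ
  have hup := huW.integrable_rpow hp
  set Y' := levelEnergy p u x₀ k' ρ with hY'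
  set Y := levelEnergy p u x₀ k (ρ - 2 * h) with hY
  have hY'0 : 0 ≤ Y' := levelEnergy_nonneg
  have hY0 : 0 ≤ Y := levelEnergy_nonneg
  have hd : 0 < k - k' := by linarith
  have hM0 : 0 ≤ M := by rw [← hM]; positivity
  set I := ∫ x in (ball x₀ (r / 2))ᶜ,
              |max (u x) 0| ^ (p - 1) * ‖x - x₀‖ ^ (-((n : ℝ) + s * p)) with hI
  have hI0 : 0 ≤ I := setIntegral_nonneg measurableSet_ball.compl fun x _ => by positivity
  have hA : MeasurableSet {x | k < u x} := measurableSet_lt measurable_const hu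
  have hA' : MeasurableSet {x | u x ≤ k} := measurableSet_le hu measurable_const
  have energy := lintegral_crossing_le hn hs0 hs1 hp hlam hLam hK hu huW hweak hk hh hhρ hΩ
    (hker h hh)
  have hlow : ENNReal.ofReal (R ^ (-((n : ℝ) + s * p)) * M * Y)
      ≤ ∫⁻ x in {x | k < u x}, ENNReal.ofReal (max (u x - k) 0 ^ p * cutoff x₀ (ρ - h) h x ^ p)
        * ∫⁻ y in {y | u y ≤ k}, ENNReal.ofReal (‖x - y‖ ^ (-((n : ℝ) + s * p))) := by
    rw [ENNReal.ofReal_mul (by positivity), hY, ← lintegral_truncation_rpow hp hu hup hk,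
      ← lintegral_indicator measurableSet_ball, ← lintegral_indicator hA,
      ← lintegral_const_mul _ ((by fun_prop : Measurable _).indicator measurableSet_ball)]
    refine lintegral_mono fun x => ?_
    by_cases hxA : k < u x
    swap
    · by_cases hxB : x ∈ ball x₀ (ρ - 2 * h) <;>
        simp [hxA, hxB, max_eq_right (sub_nonpos.2 (not_lt.1 hxA)), hp0.ne']
    by_cases hxB : x ∈ ball x₀ (ρ - 2 * h)
    swap
    · simp [hxB]
    rw [Set.indicator_of_mem hxB, Set.indicator_of_mem (show x ∈ {x | k < u x} from hxA)]
    have hx1 : ‖x - x₀‖ < ρ - 2 * h := by rwa [mem_ball, dist_eq_norm] at hxB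
    rw [cutoff_eq_one hh (by linarith), Real.one_rpow, mul_one, mul_comm]
    gcongr
    have hvol : volume (ball x R) = ENNReal.ofReal (2 * M) := by
      rw [← hMR, Measure.addHaar_ball_center]
    have hvol2 : volume (ball x R) / 2 = ENNReal.ofReal M := by
      rw [hvol, ← ENNReal.ofReal_ofNat 2, ← ENNReal.ofReal_div_of_pos two_pos]
      congr 1; ring
    have hhalf := le_lintegral_kernel_of_half hn (mul_pos hs0 hp0) hA' x (R := R) (by
      rw [hvol2, ← hM]
      refine le_trans (measure_mono fun y hy => ?_) (volume_superlevel_le hp hu hup hk' hkk)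
      refine ⟨ball_subset_ball' ?_ hy.1, (not_le.1 hy.2 : k < u y)⟩
      rw [dist_eq_norm]; linarith)
    rw [hvol2, ← ENNReal.ofReal_mul (by positivity)] at hhalf
    exact hhalf
  have hup1 : ∫⁻ x in ball x₀ ρ, ENNReal.ofReal (p ^ p * max (u x - k) 0 ^ p)
      ≤ ENNReal.ofReal (p ^ p * Y') := by
    simp_rw [ENNReal.ofReal_mul (Real.rpow_nonneg hp0.le p)]
    rw [lintegral_const_mul _ (by fun_prop), lintegral_truncation_rpow hp hu hup hk]
    gcongr
    exact levelEnergy_mono hp hu hup hk' hkk.le le_rfl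
  have hup2 : ∫⁻ x in ball x₀ ρ, ENNReal.ofReal (max (u x - k) 0)
      ≤ ENNReal.ofReal ((k - k') ^ (1 - p) * Y') := by
    rw [ENNReal.ofReal_mul (by positivity), hY', ← lintegral_truncation_rpow hp hu hup hk',
      ← lintegral_const_mul _ (by fun_prop)]
    refine lintegral_mono fun x => ?_
    rw [← ENNReal.ofReal_mul (by positivity)]
    exact ENNReal.ofReal_le_ofReal (max_sub_le_rpow hp hkk)
  have hup3 : ∫⁻ y in (ball x₀ ρ)ᶜ,
      ENNReal.ofReal (max (u y - k) 0 ^ (p - 1) * ‖y - x₀‖ ^ (-((n : ℝ) + s * p)))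
      ≤ ENNReal.ofReal I := by
    have hup' : Integrable (fun x => |max (u x) 0| ^ p) volume := by
      have := integrable_truncation_rpow hp hu hup le_rfl
      refine this.congr (Filter.Eventually.of_forall fun x => ?_)
      simp only [sub_zero]
      rw [abs_of_nonneg (le_max_right _ _)]
    have hint := integrableOn_tail hn hs0 hs1 hp (hu.max measurable_const) hup' x₀
      (half_pos hr)
    rw [hI, ofReal_integral_eq_lintegral_ofReal hint
      (Filter.Eventually.of_forall fun x => by simp only [Pi.zero_apply]; positivity)]
    refine le_trans (lintegral_mono fun x => ENNReal.ofReal_le_ofReal ?_)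
      (lintegral_mono_set (Set.compl_subset_compl.2 (ball_subset_ball (by linarith))))
    rw [abs_of_nonneg (le_max_right (u x) 0)]
    gcongr
    · linarith
  have hfinal : ENNReal.ofReal (R ^ (-((n : ℝ) + s * p)) * M * Y)
      ≤ ENNReal.ofReal (2 * Lam) * (ENNReal.ofReal (p ^ p * Y') * ENNReal.ofReal (C * h ^ (-(s * p)))
        + ENNReal.ofReal ((k - k') ^ (1 - p) * Y')
          * (ENNReal.ofReal ((ρ / h) ^ ((n : ℝ) + s * p)) * ENNReal.ofReal I)) := by
    refine (hlow.trans energy).trans ?_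
    gcongr
  have hLam0 : 0 ≤ 2 * Lam := by linarith
  rw [← ENNReal.ofReal_mul (by positivity), ← ENNReal.ofReal_mul (by positivity),
    ← ENNReal.ofReal_mul (by positivity), ← ENNReal.ofReal_add (by positivity) (by positivity),
    ← ENNReal.ofReal_mul hLam0, ENNReal.ofReal_le_ofReal_iff (by positivity)] at hfinal
  refine hfinal.trans (le_of_eq ?_)
  ring

end

/-- One step of the De Giorgi iteration. The gain is the factor `(Y' / d^p)^{sp/n}`; it comes from a
power of the measure of the superlevel set when that set is small at the scale `h`, and is trivial
otherwise. -/
lemma exists_levelEnergy_step {n : ℕ} {s p lam Lam : ℝ} (hn : 1 ≤ n) (hs0 : 0 < s) (hs1 : s < 1)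
    (hp : 1 < p) (hlam : 1 ≤ lam) (hLam : lam ≤ Lam) :
    ∃ C : ℝ, 0 < C ∧ ∀ (K : Rn n → Rn n → ℝ), IsKernel s p lam Lam K →
      ∀ (Ω : Set (Rn n)) (u : Rn n → ℝ), Measurable u → MemWsp s p u →
      (∀ η : Rn n → ℝ, MemWspZero s p Ω η → (∀ᵐ x : Rn n, 0 ≤ η x) →
        ∫ z : Rn n × Rn n,
          K z.1 z.2 * |u z.1 - u z.2| ^ (p - 2) * (u z.1 - u z.2) * (η z.1 - η z.2) ≤ 0) →
      ∀ (x₀ : Rn n) (r ρ h k k' : ℝ), 0 < r → 0 ≤ k' → k' < k → 0 < h →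
        r / 2 ≤ ρ - 2 * h → ρ ≤ r → ball x₀ ρ ⊆ Ω →
        levelEnergy p u x₀ k (ρ - 2 * h) ≤ C * ((r / h) ^ ((n : ℝ) + s * p) * h ^ (-(s * p)) *
          (1 + tail s p (fun x => max (u x) 0) x₀ (r / 2) ^ (p - 1) * (k - k') ^ (1 - p))) *
          (levelEnergy p u x₀ k' ρ / (k - k') ^ p) ^ (s * p / n) * levelEnergy p u x₀ k' ρ := by
  have : Nonempty (Fin n) := ⟨⟨0, hn⟩⟩
  have hn0 : (0 : ℝ) < n := by exact_mod_cast hn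
  have hp0 : 0 < p := by linarith
  have hsp : 0 < s * p := by positivity
  have hLam1 : 1 ≤ Lam := hlam.trans hLam
  obtain ⟨C, hC, hker⟩ := exists_lintegral_min_kernel_le hn hs0 hs1 hp
  set ω : ℝ := (volume (ball (0 : Rn n) 1)).toReal with hω
  have hω0 : 0 < ω := ENNReal.toReal_pos (measure_ball_pos _ _ one_pos).ne' measure_ball_lt_top.ne
  refine ⟨(2 / ω) ^ (s * p / n) * (1 + 4 * Lam / ω * (p ^ p * C + 1)), by positivity, ?_⟩
  intro K hK Ω u hu huW hweak x₀ r ρ h k k' hr hk' hkk hh hrρ hρr hΩ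
  have hup := huW.integrable_rpow hp
  have hd : 0 < k - k' := by linarith
  have hYY : levelEnergy p u x₀ k (ρ - 2 * h) ≤ levelEnergy p u x₀ k' ρ :=
    levelEnergy_mono hp hu hup hk' hkk.le (by linarith)
  set Y' := levelEnergy p u x₀ k' ρ with hY'
  set Y := levelEnergy p u x₀ k (ρ - 2 * h) with hY
  have hY0 : 0 ≤ Y := levelEnergy_nonneg
  set M := Y' / (k - k') ^ p with hM
  set I := ∫ x in (ball x₀ (r / 2))ᶜ,
              |max (u x) 0| ^ (p - 1) * ‖x - x₀‖ ^ (-((n : ℝ) + s * p)) with hI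
  have hI0 : 0 ≤ I := setIntegral_nonneg measurableSet_ball.compl fun x _ => by positivity
  have hT : tail s p (fun x => max (u x) 0) x₀ (r / 2) ^ (p - 1) = (r / 2) ^ (s * p) * I := by
    rw [tail, ← Real.rpow_mul (by positivity), one_div_mul_cancel (by linarith), Real.rpow_one]
  rw [hT]
  set β := s * p / n with hβ
  have hβ0 : 0 < β := by positivity
  set d1 := (k - k') ^ (1 - p) with hd1
  have hd10 : 0 < d1 := Real.rpow_pos_of_pos hd _
  set Q := (r / h) ^ ((n : ℝ) + s * p) with hQ
  have hhr : h ≤ r / 2 := by linarith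
  have hQ1 : 1 ≤ Q := Real.one_le_rpow ((one_le_div hh).2 (by linarith)) (by positivity)
  set H := h ^ (-(s * p)) with hH
  have hH0 : 0 < H := Real.rpow_pos_of_pos hh _
  set τ := (r / 2) ^ (s * p) * I with hτ
  have hτ0 : 0 ≤ τ := by positivity
  rcases (levelEnergy_nonneg : 0 ≤ levelEnergy p u x₀ k' ρ).eq_or_lt with h0 | h0
  · rw [← hY'] at h0
    rw [← h0, mul_zero]; linarith
  rw [← hY'] at h0
  have hM0 : 0 < M := by positivity
  -- `R` is the radius of a ball of measure `2 M`.
  set R := (2 * M / ω) ^ (1 / (n : ℝ)) with hR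
  have hR0 : 0 < R := by positivity
  have hRβ : R ^ (s * p) = (2 / ω) ^ β * M ^ β := by
    rw [hR, ← Real.rpow_mul (by positivity), ← Real.mul_rpow (by positivity) hM0.le, hβ]
    congr 1 <;> ring
  have hRn : R ^ (n : ℝ) * ω = 2 * M := by
    rw [hR, ← Real.rpow_mul (by positivity), one_div_mul_cancel hn0.ne', Real.rpow_one]
    field_simp
  rcases le_or_gt R h with hRh | hRh
  · have hMR : volume (ball (0 : Rn n) R) = ENNReal.ofReal (2 * M) := by
      rw [Measure.addHaar_ball_of_pos _ _ hR0, ← hRn, ENNReal.ofReal_mul (by positivity), hω,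
        ENNReal.ofReal_toReal measure_ball_lt_top.ne, Real.rpow_natCast]
      simp
    have key := levelEnergy_mul_le hn hs0 hs1 hp hlam hLam hK hu huW hweak hC.le hker hk' hkk hh hr
      hrρ hΩ hR0 hRh hM.symm hMR
    rw [← hY', ← hY, ← hI] at key
    have hIτ : I ≤ H * τ := by
      have h1 : h ^ (s * p) ≤ (r / 2) ^ (s * p) := Real.rpow_le_rpow hh.le hhr hsp.le
      have h2 : H * h ^ (s * p) = 1 := by rw [hH, ← Real.rpow_add hh]; simp
      have h3 : 1 ≤ H * (r / 2) ^ (s * p) := by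
        rw [← h2]; gcongr
      rw [hτ, ← mul_assoc]
      exact le_mul_of_one_le_left hI0 h3
    have hρQ : (ρ / h) ^ ((n : ℝ) + s * p) ≤ Q := by
      have : 0 < ρ := by linarith
      exact Real.rpow_le_rpow (by positivity) (by gcongr) (by positivity)
    have hbr : p ^ p * C * H + d1 * ((ρ / h) ^ ((n : ℝ) + s * p) * I)
        ≤ (p ^ p * C + 1) * (Q * H * (1 + τ * d1)) := by
      have a1 : d1 * ((ρ / h) ^ ((n : ℝ) + s * p) * I) ≤ d1 * (Q * (H * τ)) := by gcongr
      have a2 : p ^ p * C * H ≤ p ^ p * C * (Q * H) := by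
        gcongr; exact le_mul_of_one_le_left hH0.le hQ1
      have a3 : 0 ≤ p ^ p * C * (Q * H * (τ * d1)) := by positivity
      have a4 : 0 ≤ Q * H := by positivity
      have e : (p ^ p * C + 1) * (Q * H * (1 + τ * d1)) = p ^ p * C * (Q * H)
          + p ^ p * C * (Q * H * (τ * d1)) + Q * H + d1 * (Q * (H * τ)) := by ring
      rw [e]
      linarith
    have hcoef : R ^ (-((n : ℝ) + s * p)) * M * ((2 / ω) * ((2 / ω) ^ β * M ^ β)) = 1 := by
      rw [← hRβ, neg_add, Real.rpow_add hR0, Real.rpow_neg hR0.le, Real.rpow_neg hR0.le]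
      have e1 : M = R ^ (n : ℝ) * ω / 2 := by linarith
      rw [e1]
      have := (Real.rpow_pos_of_pos hR0 (n : ℝ)).ne'
      have := (Real.rpow_pos_of_pos hR0 (s * p)).ne'
      field_simp
    have hS0 : 0 ≤ (2 / ω) * ((2 / ω) ^ β * M ^ β) := by positivity
    have k1 := mul_le_mul_of_nonneg_right key hS0
    calc Y = R ^ (-((n : ℝ) + s * p)) * M * Y * ((2 / ω) * ((2 / ω) ^ β * M ^ β)) := by
          linear_combination (-Y) * hcoef
      _ ≤ _ := k1
      _ ≤ 2 * Lam * ((p ^ p * C + 1) * (Q * H * (1 + τ * d1))) * Y' *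
            ((2 / ω) * ((2 / ω) ^ β * M ^ β)) := by gcongr
      _ = (2 / ω) ^ β * (4 * Lam / ω * (p ^ p * C + 1)) * (Q * H * (1 + τ * d1)) * M ^ β * Y' := by
          ring
      _ ≤ _ := by
          gcongr
          linarith
  · -- Here `M` is large compared with `h^n`, and the factor `M^β` may simply be inserted.
    have h1 : 1 ≤ H * ((2 / ω) ^ β * M ^ β) := by
      rw [← hRβ]
      have h2 : H * h ^ (s * p) = 1 := by rw [hH, ← Real.rpow_add hh]; simp
      rw [← h2]; gcongr
    have h3 : 0 ≤ 4 * Lam / ω * (p ^ p * C + 1) := by positivity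
    have h4 : 0 ≤ τ * d1 := by positivity
    calc Y ≤ 1 * 1 * Y' := by linarith
      _ ≤ (H * ((2 / ω) ^ β * M ^ β)) * ((1 + 4 * Lam / ω * (p ^ p * C + 1)) *
            (Q * (1 + τ * d1))) * Y' := by
          gcongr
          exact one_le_mul_of_one_le_of_one_le (by linarith)
            (one_le_mul_of_one_le_of_one_le hQ1 (by linarith))
      _ = _ := by ring

/-! ### Iteration and conclusion -/

lemma ae_le_of_levelEnergy_eq_zero {n : ℕ} {p : ℝ} (hp : 1 < p) {u : Rn n → ℝ}
    (hu : Measurable u) (hup : Integrable (fun x => |u x| ^ p) volume) {x₀ : Rn n} {k ρ : ℝ}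
    (hk : 0 ≤ k) (h : levelEnergy p u x₀ k ρ = 0) :
    ∀ᵐ x ∂(volume.restrict (ball x₀ ρ)), u x ≤ k := by
  rw [levelEnergy, setIntegral_eq_zero_iff_of_nonneg_ae
    (Filter.Eventually.of_forall fun x => by simp only [Pi.zero_apply]; positivity)
    (integrable_truncation_rpow hp hu hup hk).integrableOn] at h
  filter_upwards [h] with x hx
  have h1 : max (u x - k) 0 = 0 := by
    rwa [Pi.zero_apply, Real.rpow_eq_zero (le_max_right _ _) (by linarith)] at hx
  linarith [le_max_left (u x - k) 0]

lemma tail_nonneg {n : ℕ} {s p : ℝ} {v : Rn n → ℝ} {x₀ : Rn n} {R : ℝ} (hR : 0 ≤ R) :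
    0 ≤ tail s p v x₀ R := by
  have : 0 ≤ ∫ x in (ball x₀ R)ᶜ, |v x| ^ (p - 1) * ‖x - x₀‖ ^ (-((n : ℝ) + s * p)) :=
    setIntegral_nonneg measurableSet_ball.compl fun x _ => by positivity
  unfold tail
  positivity

set_option maxHeartbeats 800000 in
/-- The De Giorgi iteration: if the level `k` dominates the tail and the initial energy, then `u` does
not exceed `k` in the half ball. -/
lemma exists_ae_le_level {n : ℕ} {s p lam Lam : ℝ} (hn : 1 ≤ n) (hs0 : 0 < s) (hs1 : s < 1)
    (hp : 1 < p) (hlam : 1 ≤ lam) (hLam : lam ≤ Lam) :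
    ∃ C : ℝ, 0 < C ∧ ∀ (K : Rn n → Rn n → ℝ), IsKernel s p lam Lam K →
      ∀ (Ω : Set (Rn n)) (u : Rn n → ℝ), Measurable u → MemWsp s p u →
      (∀ η : Rn n → ℝ, MemWspZero s p Ω η → (∀ᵐ x : Rn n, 0 ≤ η x) →
        ∫ z : Rn n × Rn n,
          K z.1 z.2 * |u z.1 - u z.2| ^ (p - 2) * (u z.1 - u z.2) * (η z.1 - η z.2) ≤ 0) →
      ∀ (x₀ : Rn n) (r k δ : ℝ), 0 < r → 0 < k → 0 < δ → δ ≤ 1 → ball x₀ r ⊆ Ω →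
        δ * tail s p (fun x => max (u x) 0) x₀ (r / 2) ≤ k →
        C * (r ^ (-(s * p)) * δ ^ (1 - p) * levelEnergy p u x₀ 0 r ^ (s * p / n))
          ≤ k ^ (p * (s * p / n)) →
        ∀ᵐ x ∂(volume.restrict (ball x₀ (r / 2))), u x ≤ k := by
  obtain ⟨C, hC, hstep⟩ := exists_levelEnergy_step (n := n) hn hs0 hs1 hp hlam hLam
  have hn0 : (0 : ℝ) < n := by exact_mod_cast hn
  have hp0 : 0 < p := by linarith
  have hsp : 0 < s * p := by positivity
  set β := s * p / n with hβ
  have hβ0 : 0 < β := by positivity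
  set γ := ((n : ℝ) + s * p) + s * p + (p - 1) + p * β with hγ
  have hγ0 : 0 < γ := by
    have : 0 < p * β := by positivity
    linarith
  set b := (2 : ℝ) ^ γ with hb
  have hb1 : 1 < b := Real.one_lt_rpow one_lt_two hγ0
  have hb0 : 0 < b := by linarith
  refine ⟨2 * C * 8 ^ γ * b ^ (1 / β), by positivity, ?_⟩
  intro K hK Ω u hu huW hweak x₀ r k δ hr hk hδ hδ1 hΩ hTk hsmall
  have hup := huW.integrable_rpow hp
  set T := tail s p (fun x => max (u x) 0) x₀ (r / 2) with hT
  have hT0 : 0 ≤ T := tail_nonneg (by positivity)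
  -- The levels `k (1 - 2^{-j})` increase to `k` and the radii `r/2 (1 + 2^{-j})` decrease to `r/2`.
  set Y : ℕ → ℝ := fun j => levelEnergy p u x₀ (k * (1 - (2 ^ j)⁻¹)) (r / 2 * (1 + (2 ^ j)⁻¹))
    with hY
  have hY0 : ∀ j, 0 ≤ Y j := fun j => levelEnergy_nonneg
  set A := 2 * C * 8 ^ γ * (r ^ (-(s * p)) * δ ^ (1 - p) * k ^ (-(p * β))) with hA
  have hA0 : 0 < A := by positivity
  have hTδ : T ^ (p - 1) * k ^ (1 - p) ≤ δ ^ (1 - p) := by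
    have h1 : T ≤ k / δ := by rw [le_div_iff₀ hδ]; linarith
    have h2 : T ^ (p - 1) ≤ (k / δ) ^ (p - 1) := Real.rpow_le_rpow hT0 h1 (by linarith)
    calc _ ≤ (k / δ) ^ (p - 1) * k ^ (1 - p) := by gcongr
      _ = _ := by
        rw [Real.div_rpow hk.le hδ.le, div_eq_mul_inv, ← Real.rpow_neg hδ.le, mul_right_comm,
          ← Real.rpow_add hk]
        simp
  have hδp : 1 ≤ δ ^ (1 - p) := Real.one_le_rpow_of_pos_of_le_one_of_nonpos hδ hδ1 (by linarith)
  have hrec : ∀ j, Y (j + 1) ≤ A * b ^ j * Y j ^ (1 + β) := by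
    intro j
    have h2j : (1 : ℝ) ≤ 2 ^ j := one_le_pow₀ one_le_two
    -- The step uses the length `h = r / X`; all losses are bounded by powers of `X`.
    set X : ℝ := 8 * 2 ^ j with hX
    have hX8 : 8 ≤ X := by linarith
    have hX0 : 0 < X := by linarith
    have e2 : (2 : ℝ) ^ j = X / 8 := by rw [hX]; ring
    have hinv : (0 : ℝ) < (2 ^ j)⁻¹ := by positivity
    have hinv1 : ((2 : ℝ) ^ j)⁻¹ ≤ 1 := inv_le_one_of_one_le₀ h2j
    have hinv2 : ((2 : ℝ) ^ (j + 1))⁻¹ = (2 ^ j)⁻¹ / 2 := by rw [pow_succ]; field_simp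
    have hinvX : ((2 : ℝ) ^ j)⁻¹ = 8 / X := by rw [e2, inv_div]
    have hd : k * (1 - (2 ^ (j + 1))⁻¹) - k * (1 - (2 ^ j)⁻¹) = k * (4 / X) := by
      rw [hinv2, hinvX]; ring
    have hd0 : 0 < k * (4 / X) := by positivity
    have h := hstep K hK Ω u hu huW hweak x₀ r (r / 2 * (1 + (2 ^ j)⁻¹)) (r / X)
      (k * (1 - (2 ^ (j + 1))⁻¹)) (k * (1 - (2 ^ j)⁻¹)) hr
      (mul_nonneg hk.le (by linarith)) (by linarith) (by positivity)
      (by rw [hinvX]; field_simp; nlinarith) (by nlinarith)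
      ((ball_subset_ball (by nlinarith)).trans hΩ)
    have eρ : r / 2 * (1 + (2 ^ j)⁻¹) - 2 * (r / X) = r / 2 * (1 + (2 ^ (j + 1))⁻¹) := by
      rw [hinv2, hinvX]; ring
    rw [eρ, hd] at h
    refine h.trans ?_
    change _ * (Y j / _) ^ _ * Y j ≤ _
    have f1 : r / (r / X) = X := by field_simp
    have f2 : (r / X) ^ (-(s * p)) = r ^ (-(s * p)) * X ^ (s * p) := by
      rw [Real.div_rpow hr.le hX0.le, Real.rpow_neg hX0.le, div_inv_eq_mul]
    have f3 : (k * (4 / X)) ^ (1 - p) ≤ k ^ (1 - p) * X ^ (p - 1) := by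
      rw [Real.mul_rpow hk.le (by positivity)]
      gcongr
      rw [show (1 - p) = -(p - 1) by ring, Real.rpow_neg (by positivity),
        ← Real.inv_rpow (by positivity)]
      refine Real.rpow_le_rpow (by positivity) ?_ (by linarith)
      rw [inv_div]; linarith
    have f4 : 1 + T ^ (p - 1) * (k * (4 / X)) ^ (1 - p) ≤ 2 * (δ ^ (1 - p) * X ^ (p - 1)) := by
      have g1 : T ^ (p - 1) * (k * (4 / X)) ^ (1 - p)
          ≤ T ^ (p - 1) * (k ^ (1 - p) * X ^ (p - 1)) := by gcongr
      have g2 : T ^ (p - 1) * k ^ (1 - p) * X ^ (p - 1) ≤ δ ^ (1 - p) * X ^ (p - 1) := by gcongr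
      have g3 : 1 ≤ X ^ (p - 1) := Real.one_le_rpow (by linarith) (by linarith)
      have g4 : 1 ≤ δ ^ (1 - p) * X ^ (p - 1) := one_le_mul_of_one_le_of_one_le hδp g3
      linarith
    have f5 : (Y j / (k * (4 / X)) ^ p) ^ β ≤ Y j ^ β * (k ^ (-(p * β)) * X ^ (p * β)) := by
      rw [Real.div_rpow (hY0 j) (by positivity), ← Real.rpow_mul hd0.le, div_eq_mul_inv]
      refine mul_le_mul_of_nonneg_left ?_ (Real.rpow_nonneg (hY0 j) _)
      rw [Real.mul_rpow hk.le (by positivity), mul_inv, ← Real.rpow_neg hk.le,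
        ← Real.inv_rpow (by positivity), inv_div]
      gcongr
      linarith
    have hYj : Y j ^ (1 + β) = Y j ^ β * Y j := by
      rw [Real.rpow_add_of_nonneg (hY0 j) zero_le_one hβ0.le, Real.rpow_one, mul_comm]
    have hXγ : 8 ^ γ * b ^ j = X ^ ((n : ℝ) + s * p) * X ^ (s * p) * X ^ (p - 1) * X ^ (p * β) := by
      rw [← Real.rpow_add hX0, ← Real.rpow_add hX0, ← Real.rpow_add hX0, ← hγ, hX,
        Real.mul_rpow (by norm_num) (by positivity), hb, ← Real.rpow_natCast, ← Real.rpow_natCast,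
        ← Real.rpow_mul two_pos.le, ← Real.rpow_mul two_pos.le, mul_comm γ]
    rw [f1, f2, hYj]
    have hYj0 := hY0 j
    calc _ ≤ C * (X ^ ((n : ℝ) + s * p) * (r ^ (-(s * p)) * X ^ (s * p)) *
            (2 * (δ ^ (1 - p) * X ^ (p - 1)))) * (Y j ^ β * (k ^ (-(p * β)) * X ^ (p * β)))
            * Y j := by gcongr
      _ = 2 * C * (X ^ ((n : ℝ) + s * p) * X ^ (s * p) * X ^ (p - 1) * X ^ (p * β))
            * (r ^ (-(s * p)) * δ ^ (1 - p) * k ^ (-(p * β))) * (Y j ^ β * Y j) := by ring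
      _ = _ := by rw [← hXγ, hA]; ring
  have hstart : Y 0 = levelEnergy p u x₀ 0 r := by
    simp only [hY, pow_zero, inv_one, sub_self, mul_zero]
    congr 1; ring
  have h0 : A * Y 0 ^ β * b ^ (1 / β) ≤ 1 := by
    have hkpos : 0 < k ^ (p * β) := by positivity
    have h1 := mul_le_mul_of_nonneg_right hsmall (inv_nonneg.2 hkpos.le)
    rw [mul_inv_cancel₀ hkpos.ne', ← Real.rpow_neg hk.le, ← hstart] at h1
    refine le_trans (le_of_eq ?_) h1
    rw [hA]; ring
  have hdecay := fast_geometric_decay hA0.le hb1 hβ0 hY0 hrec h0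
  refine ae_le_of_levelEnergy_eq_zero hp hu hup hk.le (le_antisymm ?_ levelEnergy_nonneg)
  have hq1 : b ^ (-(1 / β)) < 1 := by
    refine Real.rpow_lt_one_of_one_lt_of_neg hb1 ?_
    have : 0 < 1 / β := by positivity
    linarith
  have hlim : Filter.Tendsto (fun j : ℕ => Y 0 * (b ^ (-(1 / β))) ^ j) Filter.atTop (nhds 0) := by
    have := (tendsto_pow_atTop_nhds_zero_of_lt_one (by positivity) hq1).const_mul (Y 0)
    rwa [mul_zero] at this
  refine ge_of_tendsto' hlim fun j => le_trans ?_ (hdecay j)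
  have hinv : (0 : ℝ) < (2 ^ j)⁻¹ := by positivity
  have hinv1 : ((2 : ℝ) ^ j)⁻¹ ≤ 1 := inv_le_one_of_one_le₀ (one_le_pow₀ one_le_two)
  exact levelEnergy_mono hp hu hup (mul_nonneg hk.le (by linarith)) (by nlinarith) (by nlinarith)

lemma setAverage_eq_levelEnergy {n : ℕ} {p : ℝ} {u : Rn n → ℝ} {x₀ : Rn n} {r : ℝ} (hr : 0 < r) :
    ⨍ x in ball x₀ r, (max (u x) 0) ^ p
      = levelEnergy p u x₀ 0 r / (r ^ (n : ℝ) * (volume (ball (0 : Rn n) 1)).toReal) := by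
  rw [setAverage_eq, measureReal_def, Measure.addHaar_ball_of_pos _ _ hr, ENNReal.toReal_mul,
    ENNReal.toReal_ofReal (by positivity), smul_eq_mul, levelEnergy, Real.rpow_natCast]
  simp [div_eq_inv_mul]

/-- The local boundedness estimate for a subsolution with a Borel representative. -/
lemma exists_ae_le_of_measurable {n : ℕ} {s p lam Lam : ℝ} (hn : 1 ≤ n) (hs0 : 0 < s)
    (hs1 : s < 1) (hp : 1 < p) (hlam : 1 ≤ lam) (hLam : lam ≤ Lam) :
    ∃ c : ℝ, 0 < c ∧ ∀ (K : Rn n → Rn n → ℝ), IsKernel s p lam Lam K →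
      ∀ (Ω : Set (Rn n)) (u : Rn n → ℝ), Measurable u → MemWsp s p u →
      (∀ η : Rn n → ℝ, MemWspZero s p Ω η → (∀ᵐ x : Rn n, 0 ≤ η x) →
        ∫ z : Rn n × Rn n,
          K z.1 z.2 * |u z.1 - u z.2| ^ (p - 2) * (u z.1 - u z.2) * (η z.1 - η z.2) ≤ 0) →
      ∀ (x₀ : Rn n) (r : ℝ), 0 < r → ball x₀ r ⊆ Ω → ∀ (δ : ℝ), 0 < δ → δ ≤ 1 →
        ∀ᵐ x ∂(volume.restrict (ball x₀ (r / 2))),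
          u x ≤ δ * tail s p (fun x => max (u x) 0) x₀ (r / 2) +
            c * δ ^ (-((p - 1) * n / (s * p ^ 2))) *
              (⨍ x in ball x₀ r, (max (u x) 0) ^ p) ^ (1 / p) := by
  obtain ⟨C, hC, hlevel⟩ := exists_ae_le_level (n := n) hn hs0 hs1 hp hlam hLam
  have hn0 : (0 : ℝ) < n := by exact_mod_cast hn
  have hp0 : 0 < p := by linarith
  set β := s * p / n with hβ
  have hβ0 : 0 < β := by positivity
  set ω : ℝ := (volume (ball (0 : Rn n) 1)).toReal with hω
  have hω0 : 0 < ω := ENNReal.toReal_pos (measure_ball_pos _ _ one_pos).ne' measure_ball_lt_top.ne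
  refine ⟨(C * ω ^ β) ^ (1 / (p * β)), by positivity, ?_⟩
  intro K hK Ω u hu huW hweak x₀ r hr hΩ δ hδ hδ1
  have hup := huW.integrable_rpow hp
  set T := tail s p (fun x => max (u x) 0) x₀ (r / 2) with hT
  have hT0 : 0 ≤ T := tail_nonneg (by positivity)
  rw [setAverage_eq_levelEnergy hr]
  set Y := levelEnergy p u x₀ 0 r with hY
  set a := (C * ω ^ β) ^ (1 / (p * β)) * δ ^ (-((p - 1) * n / (s * p ^ 2))) *
    (Y / (r ^ (n : ℝ) * ω)) ^ (1 / p) with ha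
  rcases (levelEnergy_nonneg : 0 ≤ levelEnergy p u x₀ 0 r).eq_or_lt with h0 | h0
  · have hle := ae_le_of_levelEnergy_eq_zero hp hu hup le_rfl h0.symm
    have hY0 : 0 ≤ Y := levelEnergy_nonneg
    have ha0 : 0 ≤ δ * T + a := by positivity
    filter_upwards [ae_restrict_of_ae_restrict_of_subset
      (ball_subset_ball (by linarith : r / 2 ≤ r)) hle] with x hx
    exact hx.trans ha0
  · rw [← hY] at h0
    have ha0 : 0 < a := by positivity
    have hδT : 0 ≤ δ * T := by positivity
    refine hlevel K hK Ω u hu huW hweak x₀ r (δ * T + a) δ hr (by linarith) hδ hδ1 hΩ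
      (by linarith) ?_
    have hapow : a ^ (p * β) = C * (r ^ (-(s * p)) * δ ^ (1 - p) * Y ^ β) := by
      rw [ha, Real.mul_rpow (by positivity) (by positivity),
        Real.mul_rpow (by positivity) (by positivity), ← Real.rpow_mul (by positivity),
        ← Real.rpow_mul (by positivity), ← Real.rpow_mul (by positivity),
        one_div_mul_cancel (by positivity), Real.rpow_one]
      have e1 : -((p - 1) * n / (s * p ^ 2)) * (p * β) = 1 - p := by
        rw [hβ]; field_simp; ring
      have e2 : 1 / p * (p * β) = β := by field_simp
      have e3 : (r ^ (n : ℝ)) ^ β = r ^ (s * p) := by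
        rw [← Real.rpow_mul hr.le, hβ]; congr 1; field_simp
      rw [e1, e2, Real.div_rpow h0.le (by positivity), Real.mul_rpow (by positivity) hω0.le, e3,
        Real.rpow_neg hr.le]
      have := (Real.rpow_pos_of_pos hω0 β).ne'
      field_simp
    rw [← hapow]
    exact Real.rpow_le_rpow ha0.le (by linarith) (by positivity)

theorem theorem1p1 (n : ℕ) (hn : 1 ≤ n) (s p lam Lam : ℝ) (hs0 : 0 < s) (hs1 : s < 1)
    (hp : 1 < p) (hlam : 1 ≤ lam) (hLam : lam ≤ Lam) :
    ∃ c : ℝ, 0 < c ∧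
      ∀ (K : Rn n → Rn n → ℝ), IsKernel s p lam Lam K →
      ∀ (Ω : Set (Rn n)), IsOpen Ω → Bornology.IsBounded Ω →
      ∀ (g : Rn n → ℝ), MemWsp s p g →
      ∀ (u : Rn n → ℝ), IsWeakSubsolution s p K Ω g u →
      ∀ (x₀ : Rn n) (r : ℝ), 0 < r → ball x₀ r ⊆ Ω →
      ∀ (δ : ℝ), 0 < δ → δ ≤ 1 →
        essSup (fun x => (u x : EReal)) (volume.restrict (ball x₀ (r / 2))) ≤
          ((δ * tail s p (fun x => max (u x) 0) x₀ (r / 2) +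
            c * δ ^ (-((p - 1) * n / (s * p ^ 2))) *
              (⨍ x in ball x₀ r, (max (u x) 0) ^ p) ^ (1 / p) : ℝ) : EReal) := by
  obtain ⟨c, hc, hmain⟩ := exists_ae_le_of_measurable (n := n) hn hs0 hs1 hp hlam hLam
  refine ⟨c, hc, ?_⟩
  intro K hK Ω _ _ g _ u hsub x₀ r hr hΩ δ hδ hδ1
  -- All quantities are unchanged when `u` is replaced by a Borel representative `v`.
  have hum : AEMeasurable u volume := hsub.memWsp.1.aestronglyMeasurable.aemeasurable
  set v := hum.mk u with hv
  have huv : u =ᵐ[volume] v := hum.ae_eq_mk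
  have hfst : ∀ᵐ z : Rn n × Rn n, u z.1 = v z.1 :=
    (Measure.quasiMeasurePreserving_fst (μ := volume) (ν := volume)).ae huv
  have hsnd : ∀ᵐ z : Rn n × Rn n, u z.2 = v z.2 :=
    (Measure.quasiMeasurePreserving_snd (μ := volume) (ν := volume)).ae huv
  have hvW : MemWsp s p v := by
    refine ⟨(memLp_congr_ae huv).1 hsub.memWsp.1, (memLp_congr_ae ?_).1 hsub.memWsp.2⟩
    filter_upwards [hfst, hsnd] with z h1 h2
    rw [h1, h2]
  have hvweak : ∀ η : Rn n → ℝ, MemWspZero s p Ω η → (∀ᵐ x : Rn n, 0 ≤ η x) →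
      ∫ z : Rn n × Rn n,
        K z.1 z.2 * |v z.1 - v z.2| ^ (p - 2) * (v z.1 - v z.2) * (η z.1 - η z.2) ≤ 0 := by
    intro η hη hη0
    refine le_trans (le_of_eq (integral_congr_ae ?_)) (hsub.weak η hη hη0)
    filter_upwards [hfst, hsnd] with z h1 h2
    rw [h1, h2]
  have htail : tail s p (fun x => max (u x) 0) x₀ (r / 2)
      = tail s p (fun x => max (v x) 0) x₀ (r / 2) := by
    unfold tail
    congr 2
    refine integral_congr_ae (ae_restrict_of_ae ?_)
    filter_upwards [huv] with x hx
    rw [hx]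
  have havg : ⨍ x in ball x₀ r, (max (u x) 0) ^ p = ⨍ x in ball x₀ r, (max (v x) 0) ^ p := by
    rw [setAverage_eq, setAverage_eq]
    congr 1
    refine integral_congr_ae (ae_restrict_of_ae ?_)
    filter_upwards [huv] with x hx
    rw [hx]
  refine essSup_le_of_ae_le _ ?_
  filter_upwards [hmain K hK Ω v hum.measurable_mk hvW hvweak x₀ r hr hΩ δ hδ hδ1,
    ae_restrict_of_ae huv] with x hx hxv
  rw [htail, havg, EReal.coe_le_coe_iff, hxv]
  exact hx
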